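/- Let $n\ge 1$ and $k_1,\dots,k_n\ge 1$, and let $\nu=(NE^{k_n})\cdots(NE^{k_1})$, a lattice path of unit north and east steps from $(0,0)$ with no two consecutive north steps. *Trees.* Let $A_\nu$ be the set of lattice points weakly above $\nu$ in the smallest rectangle containing $\nu$, and $F_\nu$ the Ferrers diagram weakly above $\nu$ in this rectangle. Two points of $A_\nu$ are incompatible if one is strictly southwest of the other and the smallest rectangle containing both lies in $F_\nu$. The $\nu$-Tamari complex is the simplicial complex of sets of pairwise compatible points of $A_\nu$; its facets are the $\nu$-trees. A face is interior if it does not lie on the boundary, that is, if it is contained in no codimension-one face which lies in only one facet. A right rotation of a $\nu$-tree $T$ replaces a node $q$ by $q'$ and gives a $\nu$-tree, where $q,q'$ are the lower left and the upper right corner of a rectangle whose upper left and lower right corners $p,r$ are nodes of $T$ and which contains no node of $T$ other than $p,q,r$. The $\nu$-Tamari lattice is the set of $\nu$-trees ordered by sequences of right rotations. *Brick vectors.* Let $d(p)$ be the lattice distance of $p\in A_\nu$ to the top-left corner of $F_\nu$, and put $N=n+\sum_{i=1}^n(k_i-1)=\max_{p\in A_\nu} d(p)$. List $A_\nu=\{p_1,\dots,p_m\}$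 by columns from left to right, each column from bottom to top, and let $Q_\nu=(q_1,\dots,q_m)$ with $q_j=s_{d(p_j)+1}$, where $s_a=(a,a+1)\in\mathcal S_{N+2}$. Permutations act on $\mathbb R^{N+2}$ by $e_i\mapsto e_{w(i)}$. With $\omega_a=e_1+\dots+e_a$, the brick vector of a $\nu$-tree $T$ is $$b(T)=-\sum_{j=1}^m\Big(\prod_{i<j,\ p_i\notin T}q_i\Big)(\omega_{d(p_j)+1})\in\mathbb R^{N+2},$$ the product being taken in increasing order of $i$. Let $\tilde b(T)\in\mathbb R^N$ be obtained from $b(T)$ by omitting the first and the last coordinate. *Projection.* For $j=1,\dots,n$ let $\widetilde M_j$ be the set of the last $k_j-1$ elements of $\{1,\dots,N\}\setminus(\widetilde M_1\cup\dots\cup\widetilde M_{j-1})$, and let $M_j=\widetilde M_j\cup\{j\}$. Define $\pi:\mathbb R^N\to\mathbb R^{n-1}$ by $\pi(x)_i=\sum_{j=1}^{i}\sum_{a\in M_j}x_a$. *Paths.* Join every node of a $\nu$-tree $T$ other than the root (the top-left corner $(0,n)$) to the next node of $T$ in north or west direction. For $1\le i\le n-1$, let $P_i(T)$ be the unique shortest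 path in the resulting tree from the root to the leftmost node of $T$ on the $i$-th horizontal line, i.e. the line at height $n-i$, and let $\operatorname{area}(P_i(T))$ be the number of unit boxes to the left of $P_i(T)$. **Theorem.** The $\nu$-Tamari lattice has a least element $T_0$. Put $y(T)=\pi(\tilde b(T))-\pi(\tilde b(T_0))\in\mathbb R^{n-1}$. Then for every $\nu$-tree $T$ and every $1\le i\le n-1$ the path $P_i(T)$ is well defined and $y(T)_i=\operatorname{area}(P_i(T))$. Moreover, these coordinates determine a realization of the $\nu$-associahedron: the polytopes $\operatorname{conv}\{y(T): T \text{ a } \nu\text{-tree},\ I\subseteq T\}$, where $I$ runs over the interior faces of the $\nu$-Tamari complex, are the nonempty cells of a polytopal complex in $\mathbb R^{n-1}$, and sending $I$ to this polytope is an anti-isomorphism from the poset of interior faces to the poset of cells, both ordered by inclusion. -/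

import Mathlib

/-! ### Type `A` words, weight functions and brick vectors -/

/-- The simple transposition exchanging the consecutive elements `p` and `p + 1`
of `Fin (r + 1)`, for `p : Fin r`. -/
def simpleTransposition {r : ℕ} (p : Fin r) : Equiv.Perm (Fin (r + 1)) :=
  Equiv.swap p.castSucc p.succ

/-- The fundamental weight `ω_p = ∑_{q ≤ p} e_q`. -/
def fundamentalWeight {r : ℕ} (p : Fin r) : Fin (r + 1) → ℝ :=
  fun q => if q ≤ p.castSucc then 1 else 0

/-- The action of a permutation on vectors by permuting coordinates: `e_i ↦ e_{w i}`. -/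
def permAct {r : ℕ} (w : Equiv.Perm (Fin (r + 1))) (v : Fin (r + 1) → ℝ) :
    Fin (r + 1) → ℝ :=
  fun i => v (w⁻¹ i)

/-- The product, from left to right, of the letters of the word `Q` at the positions in `J`. -/
def subwordProd {m r : ℕ} (Q : Fin m → Fin r) (J : Finset (Fin m)) :
    Equiv.Perm (Fin (r + 1)) :=
  (((List.finRange m).filter (fun j => j ∈ J)).map (fun j => simpleTransposition (Q j))).prod

/-- The weight function `ω(I, j) = ∏ Q_{{1, …, j-1} ∖ I} (ω_{q_j})`. -/
noncomputable def weightFunction {m r : ℕ} (Q : Fin m → Fin r) (I : Finset (Fin m))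
    (j : Fin m) : Fin (r + 1) → ℝ :=
  permAct (subwordProd Q (Finset.univ.filter (fun i => i < j ∧ i ∉ I))) (fundamentalWeight (Q j))

/-- The brick vector `b(I) = - ∑_j ω(I, j)`. -/
noncomputable def brickVector {m r : ℕ} (Q : Fin m → Fin r) (I : Finset (Fin m)) :
    Fin (r + 1) → ℝ :=
  - ∑ j, weightFunction Q I j

/-! ### Lattice paths, `ν`-trees and the rotation order -/

/-- The unit steps of a lattice path. -/
inductive PathStep
  | N
  | E
  deriving DecidableEq

/-- The number of north steps of `ν`. -/
def pathHeight (ν : List PathStep) : ℕ := ν.count PathStep.N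

/-- The number of east steps of `ν`. -/
def pathWidth (ν : List PathStep) : ℕ := ν.count PathStep.E

/-- The set `A_ν` of lattice points `(x, y)` of the smallest rectangle containing `ν` that are
weakly above `ν`, where `ν` starts at `(0, 0)`: to the east of `(x, y)`, or at `(x, y)`,
there is a point of `ν` on the same horizontal line. -/
def latticePointsAbove (ν : List PathStep) : Finset (ℕ × ℕ) :=
  (Finset.range (pathWidth ν + 1) ×ˢ Finset.range (pathHeight ν + 1)).filter
    (fun p => ∃ l ∈ ν.inits, pathHeight l = p.2 ∧ p.1 ≤ pathWidth l)

/-- The lattice distance from a point to the top-left corner `(0, pathHeight ν)`. -/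
def distTopLeft (ν : List PathStep) (p : ℕ × ℕ) : ℕ := p.1 + (pathHeight ν - p.2)

/-- `p` and `q` are `ν`-incompatible: one of them is (strictly) southwest of the other, and the
smallest rectangle containing both lies in the Ferrers diagram above `ν`, that is, all its lattice
points are weakly above `ν`. -/
def NuIncompatible (ν : List PathStep) (p q : ℕ × ℕ) : Prop :=
  ((p.1 < q.1 ∧ p.2 < q.2) ∨ (q.1 < p.1 ∧ q.2 < p.2)) ∧
    Finset.Icc (p ⊓ q) (p ⊔ q) ⊆ latticePointsAbove ν

/-- The faces of the `ν`-Tamari complex: sets of pairwise `ν`-compatible points of `A_ν`. -/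
def IsTamariFace (ν : List PathStep) (I : Finset (ℕ × ℕ)) : Prop :=
  I ⊆ latticePointsAbove ν ∧ ∀ p ∈ I, ∀ q ∈ I, ¬ NuIncompatible ν p q

/-- The `ν`-trees, i.e. the facets of the `ν`-Tamari complex. -/
def IsNuTree (ν : List PathStep) (T : Finset (ℕ × ℕ)) : Prop :=
  Maximal (IsTamariFace ν) T

/-- `T'` is obtained from `T` by a right rotation: `q` is replaced by `q'`, where `p` is north of
`q` in `T`, `r` is east of `q` in `T`, the rectangle spanned by `p` and `r` contains no further
node of `T`, and `q'` is its upper right corner. -/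
def IsRightRotation (ν : List PathStep) (T T' : Finset (ℕ × ℕ)) : Prop :=
  IsNuTree ν T ∧ IsNuTree ν T' ∧
    ∃ p q r : ℕ × ℕ, p.1 = q.1 ∧ q.2 < p.2 ∧ r.2 = q.2 ∧ q.1 < r.1 ∧
      T ∩ Finset.Icc q (r.1, p.2) = {p, q, r} ∧ T' = insert (r.1, p.2) (T.erase q)

/-- `T₀` is the least element of the rotation order on `ν`-trees, i.e. the minimal element of
the `ν`-Tamari lattice. -/
def IsLeastNuTree (ν : List PathStep) (T₀ : Finset (ℕ × ℕ)) : Prop :=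
  IsNuTree ν T₀ ∧ ∀ T, IsNuTree ν T → Relation.ReflTransGen (IsRightRotation ν) T₀ T

/-- A face of the `ν`-Tamari complex is interior if it does not lie on the boundary, where the
boundary is generated by the codimension-one faces `T ∖ {q}` that are contained in only one
facet. -/
def IsInteriorFace (ν : List PathStep) (I : Finset (ℕ × ℕ)) : Prop :=
  IsTamariFace ν I ∧ ∀ T, IsNuTree ν T → ∀ q ∈ T, I ⊆ T.erase q →
    ∃ T', IsNuTree ν T' ∧ T' ≠ T ∧ T.erase q ⊆ T'

/-! ### The word `Q_ν` and the brick vectors of `ν`-trees -/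

/-- The points of `A_ν`, the columns read from left to right and each of them
from bottom to top. -/
def readingOrder (ν : List PathStep) : List (ℕ × ℕ) :=
  (List.range (pathWidth ν + 1)).flatMap (fun x =>
    ((List.range (pathHeight ν + 1)).map (fun y => (x, y))).filter
      (fun p => p ∈ latticePointsAbove ν))

theorem mem_latticePointsAbove_of_mem_readingOrder {ν : List PathStep} {p : ℕ × ℕ}
    (h : p ∈ readingOrder ν) : p ∈ latticePointsAbove ν := by
  unfold readingOrder at h
  rw [List.mem_flatMap] at h
  obtain ⟨x, -, hx⟩ := h
  simpa using (List.mem_filter.mp hx).2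

/-- The maximal lattice distance of a point of `A_ν` to the top-left corner. -/
def maxDist (ν : List PathStep) : ℕ := (latticePointsAbove ν).sup (distTopLeft ν)

/-- The word `Q_ν`: the point `p` is labeled by `s_{d(p) + 1}`, which is the letter `d(p)` in
zero-based numbering. The simple transpositions that occur are `s_1, …, s_{maxDist ν + 1}`. -/
def nuWord (ν : List PathStep) (j : Fin (readingOrder ν).length) : Fin (maxDist ν + 1) :=
  ⟨distTopLeft ν ((readingOrder ν).get j), Nat.lt_succ_of_le (Finset.le_sup
    (f := distTopLeft ν) (mem_latticePointsAbove_of_mem_readingOrder (List.get_mem _ j)))⟩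

/-- The brick vector `b(T)` of a `ν`-tree `T`: the brick vector for the word `Q_ν` of the facet
which consists of the positions of the nodes of `T`. -/
noncomputable def nuBrickVector (ν : List PathStep) (T : Finset (ℕ × ℕ)) :
    Fin (maxDist ν + 1 + 1) → ℝ :=
  brickVector (nuWord ν) (Finset.univ.filter (fun j => (readingOrder ν).get j ∈ T))

/-- The vector `b̃(T)`: the brick vector without its first and its last coordinate. -/
noncomputable def truncatedBrickVector (ν : List PathStep) (T : Finset (ℕ × ℕ)) :
    Fin (maxDist ν) → ℝ :=
  fun i => nuBrickVector ν T i.succ.castSucc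

/-! ### Paths without consecutive north steps and the projection -/

/-- The path `(N E^{k_n}) ⋯ (N E^{k_1})`. -/
def nePath (n : ℕ) (k : ℕ → ℕ) : List PathStep :=
  (List.range n).flatMap (fun j => PathStep.N :: List.replicate (k (n - j)) PathStep.E)

theorem pathHeight_le_pathWidth_of_suffix (k : ℕ → ℕ) (L : List ℕ) (hL : ∀ j ∈ L, 1 ≤ k j) :
    ∀ s, s <:+ L.flatMap (fun j => PathStep.N :: List.replicate (k j) PathStep.E) →
      pathHeight s ≤ pathWidth s := by
  induction L with
  | nil =>
    intro s hs
    simp at hs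
    simp [hs, pathHeight]
  | cons a L ih =>
    intro s hs
    have ih' := ih (fun j hj => hL j (by simp [hj]))
    have ha := hL a (by simp)
    rw [List.flatMap_cons] at hs
    rcases List.suffix_or_suffix_of_suffix hs (List.suffix_append _ _) with h | h
    · exact ih' s h
    · obtain ⟨t, rfl⟩ := h
      have h0 := ih' _ (List.suffix_refl _)
      have ht : t <:+ PathStep.N :: List.replicate (k a) PathStep.E := by
        obtain ⟨u, hu⟩ := hs
        rw [← List.append_assoc] at hu
        exact ⟨u, List.append_cancel_right hu⟩
      have h1 : pathHeight t ≤ pathWidth t := by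
        rcases List.suffix_cons_iff.mp ht with rfl | h
        · simp [pathHeight, pathWidth, List.count_replicate]
          omega
        · have : t.count PathStep.N = 0 := by
            have := h.sublist.count_le PathStep.N
            simpa [List.count_replicate] using this
          simp [pathHeight, this]
      simp only [pathHeight, pathWidth, List.count_append] at *
      omega

/-- For the paths `(N E^{k_n}) ⋯ (N E^{k_1})` the number of coordinates of `b̃(T)`
is `n + ∑ (k_i - 1)`. -/
theorem maxDist_nePath (n : ℕ) (k : ℕ → ℕ) (hk : ∀ i ∈ Finset.Icc 1 n, 1 ≤ k i) :
    maxDist (nePath n k) = n + ∑ i ∈ Finset.Icc 1 n, (k i - 1) := by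
  have hw : pathWidth (nePath n k) = n + ∑ i ∈ Finset.Icc 1 n, (k i - 1) := by
    have h1 : pathWidth (nePath n k) = ∑ j ∈ Finset.range n, k (n - j) := by
      have h : ∀ f : ℕ → ℕ, ∑ j ∈ Finset.range n, f j = ((List.range n).map f).sum :=
        fun f => rfl
      rw [h]
      simp [pathWidth, nePath, List.count_flatMap, Function.comp_def]
    have h2 : ∑ j ∈ Finset.range n, k (n - j) = ∑ i ∈ Finset.Icc 1 n, k i := by
      refine Finset.sum_bij' (fun j _ => n - j) (fun i _ => n - i) ?_ ?_ ?_ ?_ ?_ <;>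
        intro a ha <;> simp at ha ⊢ <;> omega
    have h3 : ∑ i ∈ Finset.Icc 1 n, k i = ∑ i ∈ Finset.Icc 1 n, (1 + (k i - 1)) :=
      Finset.sum_congr rfl (fun i hi => by have := hk i hi; omega)
    rw [h1, h2, h3, Finset.sum_add_distrib]
    simp
  rw [← hw]
  apply le_antisymm
  · refine Finset.sup_le (fun p hp => ?_)
    obtain ⟨-, l, hl, hl1, hl2⟩ := Finset.mem_filter.mp hp
    obtain ⟨r, hr⟩ := (List.mem_inits _ _).mp hl
    have h : pathHeight r ≤ pathWidth r := by
      have := pathHeight_le_pathWidth_of_suffix k ((List.range n).map (fun j => n - j))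
        (by
          intro j hj
          simp only [List.mem_map, List.mem_range] at hj
          obtain ⟨i, hi, rfl⟩ := hj
          exact hk _ (by simp; omega)) r
      apply this
      rw [List.flatMap_map]
      exact ⟨l, hr⟩
    have e1 : pathHeight (nePath n k) = pathHeight l + pathHeight r := by
      rw [← hr]; simp [pathHeight]
    have e2 : pathWidth (nePath n k) = pathWidth l + pathWidth r := by
      rw [← hr]; simp [pathWidth]
    unfold distTopLeft
    omega
  · have hmem : (pathWidth (nePath n k), pathHeight (nePath n k)) ∈
        latticePointsAbove (nePath n k) := by
      refine Finset.mem_filter.mpr ⟨by simp, nePath n k, by simp, rfl, le_rfl⟩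
    have := Finset.le_sup (f := distTopLeft (nePath n k)) hmem
    simp only [distTopLeft, Nat.sub_self, Nat.add_zero] at this
    exact this

/-- The last (i.e. largest) `c` elements of `s`. -/
def lastElements (c : ℕ) (s : Finset ℕ) : Finset ℕ :=
  s.filter (fun x => (s.filter (fun z => x < z)).card < c)

/-- The set `[N] ∖ (M̃_1 ∪ ⋯ ∪ M̃_j)`. -/
def remainingIndices (k : ℕ → ℕ) (N : ℕ) : ℕ → Finset ℕ
  | 0 => Finset.Icc 1 N
  | j + 1 => remainingIndices k N j \ lastElements (k (j + 1) - 1) (remainingIndices k N j)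

/-- The set `M̃_j`: the last `k_j - 1` elements of `[N] ∖ (M̃_1 ∪ ⋯ ∪ M̃_{j-1})`, for `j ≥ 1`. -/
def tildeM (k : ℕ → ℕ) (N j : ℕ) : Finset ℕ :=
  lastElements (k j - 1) (remainingIndices k N (j - 1))

/-- The set `M_j = M̃_j ∪ {j}`. -/
def setM (k : ℕ → ℕ) (N j : ℕ) : Finset ℕ := tildeM k N j ∪ {j}

/-- The projection `π₁`, with `j`-th coordinate `∑_{i ∈ M_j} x_i`. Coordinates are numbered from
`1` in the sets `M_j` and from `0` in `Fin`. -/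
noncomputable def projOne (n : ℕ) (k : ℕ → ℕ) {N : ℕ} (x : Fin N → ℝ) : Fin n → ℝ :=
  fun j => ∑ i ∈ Finset.univ.filter (fun i : Fin N => (i : ℕ) + 1 ∈ setM k N ((j : ℕ) + 1)), x i

/-- The projection `π₂`, given by the partial sums except the last one. -/
noncomputable def projTwo {n : ℕ} (z : Fin n → ℝ) : Fin (n - 1) → ℝ :=
  fun i => ∑ j ∈ Finset.univ.filter (fun j : Fin n => (j : ℕ) ≤ (i : ℕ)), z j

/-- The projection `π = π₂ ∘ π₁`. -/
noncomputable def proj (n : ℕ) (k : ℕ → ℕ) {N : ℕ} (x : Fin N → ℝ) : Fin (n - 1) → ℝ :=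
  projTwo (projOne n k x)

/-- The vector `y(T) = π(b̃(T)) - π(b̃(T₀))`. -/
noncomputable def yVector (n : ℕ) (k : ℕ → ℕ) (T₀ T : Finset (ℕ × ℕ)) : Fin (n - 1) → ℝ :=
  proj n k (truncatedBrickVector (nePath n k) T) - proj n k (truncatedBrickVector (nePath n k) T₀)

/-! ### The binary tree of a `ν`-tree and areas of paths -/

/-- `q` is the next node of `T` after `p` in north or in west direction. -/
def IsNextNode (T : Finset (ℕ × ℕ)) (p q : ℕ × ℕ) : Prop :=
  p ∈ T ∧ q ∈ T ∧
    ((q.1 = p.1 ∧ p.2 < q.2 ∧ ∀ z ∈ T, z.1 = p.1 → p.2 < z.2 → q.2 ≤ z.2) ∨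
      (q.2 = p.2 ∧ q.1 < p.1 ∧ ∀ z ∈ T, z.2 = p.2 → z.1 < p.1 → z.1 ≤ q.1))

/-- The tree of `T`: every node is joined to the next one in north or west direction. -/
def treeGraph (T : Finset (ℕ × ℕ)) : SimpleGraph (ℕ × ℕ) where
  Adj p q := IsNextNode T p q ∨ IsNextNode T q p
  symm := ⟨fun _ _ h => h.symm⟩
  loopless := ⟨fun p h => by
    rcases h with ⟨-, -, h | h⟩ | ⟨-, -, h | h⟩ <;> omega⟩

/-- The root, i.e. the top-left corner of the Ferrers diagram. -/
def nuRoot (ν : List PathStep) : ℕ × ℕ := (0, pathHeight ν)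

/-- `v` is the leftmost node of `T` on the horizontal line at height `h`. -/
def IsLeftmostNode (T : Finset (ℕ × ℕ)) (h : ℕ) (v : ℕ × ℕ) : Prop :=
  v ∈ T ∧ v.2 = h ∧ ∀ u ∈ T, u.2 = h → v.1 ≤ u.1

/-- A walk of minimal length between its end points. -/
def IsShortestWalk {V : Type*} {G : SimpleGraph V} {u v : V} (P : G.Walk u v) : Prop :=
  ∀ P' : G.Walk u v, P.length ≤ P'.length

/-- The number of unit boxes to the left of the walk `P`. The box with lower left corner `(a, b)`,
inside the smallest rectangle containing `ν`, is to the left of `P` if `P` has a vertical edge to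
the right of the box which passes from height `b` to height `b + 1`. -/
def walkArea (ν : List PathStep) {T : Finset (ℕ × ℕ)} {u v : ℕ × ℕ} (P : (treeGraph T).Walk u v) :
    ℕ :=
  ((Finset.range (pathWidth ν) ×ˢ Finset.range (pathHeight ν)).filter (fun c =>
    ∃ d ∈ P.darts, d.fst.1 = d.snd.1 ∧ c.1 < d.fst.1 ∧
      min d.fst.2 d.snd.2 ≤ c.2 ∧ c.2 < max d.fst.2 d.snd.2)).card

/-! ### Polytopal complexes and realizations of the `ν`-associahedron -/

/-- `K` is the set of nonempty cells of a polytopal complex in `ℝ^d`: finitely many polytopes,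
such that every nonempty face of a cell is a cell, and the intersection of two cells is a (possibly
empty) face of both of them. -/
structure IsPolytopalComplex {d : ℕ} (K : Set (Set (Fin d → ℝ))) : Prop where
  finite : K.Finite
  nonempty : ∀ P ∈ K, P.Nonempty
  polytope : ∀ P ∈ K, ∃ V : Finset (Fin d → ℝ), P = convexHull ℝ (V : Set (Fin d → ℝ))
  face_mem : ∀ P ∈ K, ∀ F : Set (Fin d → ℝ), F.Nonempty → IsExposed ℝ P F → F ∈ K
  inter_face : ∀ P ∈ K, ∀ P' ∈ K, IsExposed ℝ P (P ∩ P') ∧ IsExposed ℝ P' (P ∩ P')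

/-- The points `y T`, for the `ν`-trees `T`, are the vertex coordinates of a realization of the
`ν`-associahedron: there is a polytopal complex, whose poset of cells ordered by inclusion is
anti-isomorphic to the poset of interior faces of the `ν`-Tamari complex, in such a way that the
cell of an interior face `I` is the convex hull of the points `y T` with `I ⊆ T`; in particular
the `ν`-tree `T` corresponds to the vertex `y T`. -/
def RealizesNuAssociahedron (ν : List PathStep) {d : ℕ}
    (y : Finset (ℕ × ℕ) → (Fin d → ℝ)) : Prop :=
  ∃ K : Set (Set (Fin d → ℝ)), IsPolytopalComplex K ∧
    ∃ e : {I : Finset (ℕ × ℕ) // IsInteriorFace ν I} ≃o (↥K)ᵒᵈ,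
      ∀ I, ((OrderDual.ofDual (e I) : ↥K) : Set (Fin d → ℝ)) =
        convexHull ℝ (y '' {T | IsNuTree ν T ∧ I.1 ⊆ T})

/-! ### Trees in a staircase shape -/

/-! The diagram is treated as a shape whose rows `0, …, n` have strictly increasing widths `W h`.
Points `(a, b)` and `(c, d)` with `a < c` and `b < d` conflict exactly when the lower right corner
`(c, b)` of their rectangle lies in the shape, that is, when `c ≤ W b`. The two halves of the
theorem meet in `pathArea`.

Areas. Points of `A_ν` outside `T` are crossings of pipes, nodes of `T` are contacts. Pairing a
brick vector with a 0/1 labelling of the pipes gives minus the number of labelled pipes above `p`,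
summed over all points `p` (`sum_mul_brickVector`). For `J = n - i`, the `i`-th coordinate of `π` is
the sum over `{1, …, N}` minus the sum over the interval labelled by `rowLabel`. The first sum does
not depend on `T`, since no crossing mixes the labels. For the second, all pipes entering a row up
to `J` from the south inside its width are labelled, while above row `J` exactly one of the columns
`0, …, W J` lacks a labelled pipe. This gap moves from row to row by the recursion that describes
the path from the root to the leftmost node of row `J` (`south_eq`, `pathColumn_succ`). Hence the
count varies with `T` only through the columns of the gap, whose sum is the area.

Realization. With `y_0 = y_n = 0`, call `(x, h)` tight at `y` if it minimizes `y_h + x h` among the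
rows that meet column `x`. Conflicting points are never tight together, because the term `x h` is
strictly supermodular, so tight sets are faces. Two area estimates (`pathArea_le_of_lt`,
`pathArea_ge_of_gt`) make every node of `T` tight at its area vector; by maximality the tight set is
then `T`. The interior faces are those that contain the root and all row ends and meet every column.
The root and the row ends bound the cell of such a face, and its point in each column turns
tightness of further points into equality in a linear inequality valid on the cell. This gives
convex hulls of vertices, faces and intersections by polyhedral arguments.

Least tree. Left rotations lower the total height of the nodes and are available until the tree on
the left and lower boundary is reached. -/

/-- The row widths `W 0 = 0 < W 1 < ⋯ < W n` of a Ferrers diagram. -/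
structure IsShape (n : ℕ) (W : ℕ → ℕ) : Prop where
  zero : W 0 = 0
  step : ∀ h < n, W h < W (h + 1)

theorem IsShape.lt {n : ℕ} {W : ℕ → ℕ} (hW : IsShape n W) {a b : ℕ} (hab : a < b) (hb : b ≤ n) :
    W a < W b := by
  induction b, hab using Nat.le_induction with
  | base => exact hW.step _ (by omega)
  | succ b hab ih => exact (ih (by omega)).trans (hW.step _ (by omega))

theorem IsShape.le {n : ℕ} {W : ℕ → ℕ} (hW : IsShape n W) {a b : ℕ} (hab : a ≤ b) (hb : b ≤ n) :
    W a ≤ W b := by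
  rcases hab.eq_or_lt with rfl | h
  · rfl
  · exact (hW.lt h hb).le

theorem IsShape.add_le {n : ℕ} {W : ℕ → ℕ} (hW : IsShape n W) {a b : ℕ} (hab : a ≤ b)
    (hb : b ≤ n) : W a + (b - a) ≤ W b := by
  induction b, hab using Nat.le_induction with
  | base => simp
  | succ b hab ih =>
    have := ih (by omega)
    have := hW.step b (by omega)
    omega

/-- A set of points of the shape, no two of which span a rectangle in the shape in southwest to
northeast direction. -/
structure IsFace (n : ℕ) (W : ℕ → ℕ) (T : Finset (ℕ × ℕ)) : Prop where
  above : ∀ a b, (a, b) ∈ T → b ≤ n ∧ a ≤ W b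
  compat : ∀ a b c d, (a, b) ∈ T → (c, d) ∈ T → a < c → b < d → W b < c

/-- A maximal face. -/
structure IsFacet (n : ℕ) (W : ℕ → ℕ) (T : Finset (ℕ × ℕ)) : Prop extends IsFace n W T where
  exists_conflict : ∀ a b, b ≤ n → a ≤ W b → (a, b) ∉ T →
    ∃ c d, (c, d) ∈ T ∧ ((c < a ∧ d < b ∧ a ≤ W d) ∨ (a < c ∧ b < d ∧ c ≤ W b))

/-- The leftmost node of `T` at height `h`. -/
noncomputable def leftmost (T : Finset (ℕ × ℕ)) (h : ℕ) : ℕ := sInf {x | (x, h) ∈ T}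

theorem exists_nearest_below {P : ℕ → Prop} {c x : ℕ} (hc : P c) (hcx : c < x) :
    ∃ d, d < x ∧ P d ∧ ∀ a, d < a → a < x → ¬ P a := by
  classical
  refine ⟨Nat.findGreatest P (x - 1), ?_, Nat.findGreatest_spec (m := c) (by omega) hc, ?_⟩
  · have := Nat.findGreatest_le (P := P) (x - 1)
    omega
  · intro a h1 h2
    exact Nat.findGreatest_is_greatest h1 (by omega)

theorem exists_nearest_above {P : ℕ → Prop} {c x : ℕ} (hc : P c) (hcx : x < c) :
    ∃ d, x < d ∧ P d ∧ ∀ a, x < a → a < d → ¬ P a := by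
  classical
  have h : ∃ d, x < d ∧ P d := ⟨c, hcx, hc⟩
  refine ⟨Nat.find h, (Nat.find_spec h).1, (Nat.find_spec h).2, fun a h1 h2 h3 => ?_⟩
  exact Nat.find_min h h2 ⟨h1, h3⟩

namespace IsFacet

variable {n : ℕ} {W : ℕ → ℕ} {T : Finset (ℕ × ℕ)}

theorem eq_of_subset (hT : IsFacet n W T) {T' : Finset (ℕ × ℕ)} (hT' : IsFace n W T')
    (h : T ⊆ T') : T' = T := by
  refine (Finset.Subset.antisymm h fun p hp => ?_).symm
  obtain ⟨a, b⟩ := p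
  by_contra hn
  obtain ⟨h1, h2⟩ := hT'.above a b hp
  obtain ⟨c, d, hcd, ⟨h3, h4, h5⟩ | ⟨h3, h4, h5⟩⟩ := hT.exists_conflict a b h1 h2 hn
  · have := hT'.compat c d a b (h hcd) hp h3 h4; omega
  · have := hT'.compat a b c d hp (h hcd) h3 h4; omega

theorem end_mem (hT : IsFacet n W T) (hW : IsShape n W) {h : ℕ} (hh : h ≤ n) : (W h, h) ∈ T := by
  by_contra hn
  obtain ⟨c, d, -, ⟨h3, h4, h5⟩ | ⟨h3, h4, h5⟩⟩ := hT.exists_conflict _ h hh le_rfl hn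
  · have := hW.lt h4 hh; omega
  · omega

theorem root_mem (hT : IsFacet n W T) : (0, n) ∈ T := by
  by_contra hn
  obtain ⟨c, d, hcd, ⟨h3, h4, h5⟩ | ⟨h3, h4, h5⟩⟩ := hT.exists_conflict 0 n le_rfl (by simp) hn
  · omega
  · have := (hT.above c d hcd).1; omega

theorem leftmost_mem (hT : IsFacet n W T) (hW : IsShape n W) {h : ℕ} (hh : h ≤ n) :
    (leftmost T h, h) ∈ T :=
  Nat.sInf_mem (s := {x | (x, h) ∈ T}) ⟨_, hT.end_mem hW hh⟩

end IsFacet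

theorem leftmost_le {T : Finset (ℕ × ℕ)} {x h : ℕ} (hx : (x, h) ∈ T) : leftmost T h ≤ x :=
  Nat.sInf_le hx

namespace IsFacet

variable {n : ℕ} {W : ℕ → ℕ} {T : Finset (ℕ × ℕ)}

theorem leftmost_le_width (hT : IsFacet n W T) (hW : IsShape n W) {h : ℕ} (hh : h ≤ n) :
    leftmost T h ≤ W h :=
  leftmost_le (hT.end_mem hW hh)

theorem leftmost_top (hT : IsFacet n W T) : leftmost T n = 0 :=
  Nat.le_zero.mp (leftmost_le hT.root_mem)

/-- A node to the west and a node to the north of `(x, h)` would conflict, since the corner `(x, h)`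
of their rectangle lies in the shape. -/
theorem not_north_and_west (hT : IsFacet n W T) {x h c d : ℕ} (hx : (x, h) ∈ T)
    (hd : (x, d) ∈ T) (hhd : h < d) (hc : (c, h) ∈ T) (hcx : c < x) : False := by
  have := hT.compat c h x d hc hd hcx hhd
  have := (hT.above x h hx).2
  omega

/-- If both were missing, some column left of `x` would have a node above row `h`; let `a` be the
rightmost such column. The absent point `(a, h)` must conflict with a node, and every candidate is
ruled out by `(x, h)`, by the node above `(a, h)` or by the choice of `a`. Together with
`not_north_and_west` this is what makes the nodes a rooted tree. -/
theorem north_or_west (hT : IsFacet n W T) {x h : ℕ} (hx : (x, h) ∈ T)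
    (hr : (x, h) ≠ (0, n)) : (∃ d, h < d ∧ (x, d) ∈ T) ∨ ∃ c < x, (c, h) ∈ T := by
  by_contra! hno
  obtain ⟨hN, hE⟩ := hno
  obtain ⟨hh, hxW⟩ := hT.above x h hx
  have hx0 : 0 < x := by
    rcases Nat.eq_zero_or_pos x with rfl | h0
    · have h1 : h ≠ n := fun e => hr (by rw [e])
      exact absurd hT.root_mem (hN n (by omega))
    · exact h0
  have hP : ∃ a, a < x ∧ ∃ b, (a, b) ∈ T ∧ h < b := by
    have h0 : (0, h) ∉ T := hE 0 hx0
    obtain ⟨c, d, hcd, ⟨h3, h4, h5⟩ | ⟨h3, h4, h5⟩⟩ :=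
      hT.exists_conflict 0 h hh (by omega) h0
    · omega
    · refine ⟨c, ?_, d, hcd, h4⟩
      rcases lt_trichotomy c x with h6 | rfl | h6
      · exact h6
      · exact absurd hcd (hN d h4)
      · have := hT.compat x h c d hx hcd h6 h4; omega
  obtain ⟨a, hax, ⟨b, hab, hhb⟩⟩ := hP
  obtain ⟨a, hax, ⟨b, hab, hhb⟩, hmax⟩ := exists_nearest_below
    (P := fun a => ∃ b, (a, b) ∈ T ∧ h < b) ⟨b, hab, hhb⟩ hax
  obtain ⟨c, d, hcd, ⟨h3, h4, h5⟩ | ⟨h3, h4, h5⟩⟩ :=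
    hT.exists_conflict a h hh (by omega) (hE a hax)
  · have := hT.compat c d a b hcd hab h3 (by omega)
    omega
  · rcases lt_trichotomy c x with h6 | rfl | h6
    · exact hmax c h3 h6 ⟨d, hcd, h4⟩
    · exact hN d h4 hcd
    · have := hT.compat x h c d hx hcd h6 h4; omega

/-- In an empty column the top point has a conflicting node to its southwest. In the lowest row `s`
with this property that node lies in row `s - 1`. The absent point `(x, s - 1)` then has no conflict
left: none from the southwest by minimality of `s`, none from the northeast because of that node. -/
theorem exists_mem_column (hT : IsFacet n W T) (hW : IsShape n W) {x : ℕ} (hx : x ≤ W n) :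
    ∃ h, (x, h) ∈ T := by
  by_contra! hno
  have hP : ∃ s, s ≤ n ∧ x ≤ W s ∧ ∃ c d, (c, d) ∈ T ∧ c < x ∧ d < s ∧ x ≤ W d := by
    obtain ⟨c, d, hcd, ⟨h3, h4, h5⟩ | ⟨h3, h4, h5⟩⟩ := hT.exists_conflict x n le_rfl hx (hno n)
    · exact ⟨n, le_rfl, hx, c, d, hcd, h3, h4, h5⟩
    · have := (hT.above c d hcd).1; omega
  classical
  obtain ⟨⟨hs, hxs, c, d, hcd, h1, h2, h3⟩, hmin⟩ := And.intro (Nat.find_spec hP)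
    (fun m (hm : m < Nat.find hP) => Nat.find_min hP hm)
  set s := Nat.find hP
  have hxs' : x ≤ W (s - 1) := h3.trans (hW.le (by omega) (by omega))
  have hnot := hmin (s - 1) (by omega)
  have hd : d = s - 1 := by
    by_contra hne
    exact hnot ⟨by omega, hxs', c, d, hcd, h1, by omega, h3⟩
  obtain ⟨c', d', hcd', ⟨h3', h4', h5'⟩ | ⟨h3', h4', h5'⟩⟩ :=
    hT.exists_conflict x (s - 1) (by omega) hxs' (hno _)
  · exact hnot ⟨by omega, hxs', c', d', hcd', h3', h4', h5'⟩
  · have := hT.compat c d c' d' hcd hcd' (by omega) (by omega)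
    subst hd
    omega

/-- The key property of the rows of a tree. -/
theorem mem_of_leftmost_le (hT : IsFacet n W T) (hW : IsShape n W) {J t i : ℕ} (hJt : J ≤ t)
    (hti : t < i) (hi : i ≤ n) (ht : leftmost T t ≤ W J)
    (hgap : ∀ s, t < s → s < i → W J < leftmost T s) (hl : leftmost T i ≤ W J) :
    (leftmost T t, i) ∈ T ∧ ∀ x, (x, i) ∈ T → x ≤ W J → x ≤ leftmost T t := by
  have hJt' : W J ≤ W t := hW.le hJt (by omega)
  have hti' : W t ≤ W i := hW.le hti.le hi
  have hmem := hT.leftmost_mem hW (h := t) (by omega)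
  have hright : ∀ x, (x, i) ∈ T → x ≤ W J → x ≤ leftmost T t := by
    intro x hx hxJ
    by_contra hlt
    have := hT.compat _ t x i hmem hx (by omega) hti
    omega
  refine ⟨?_, hright⟩
  by_contra hn
  have hli := hT.leftmost_mem hW hi
  have hle := hright _ hli hl
  have hne : leftmost T i ≠ leftmost T t := fun e => hn (e ▸ hli)
  -- A conflict from the southwest lies below row `t`, in row `t` or between `t` and `i`; these are
  -- excluded by the node `(leftmost T t, t)`, by its being leftmost, and by `hgap`. A conflict from
  -- the northeast would also conflict with the leftmost node of row `i`.
  obtain ⟨c, d, hcd, ⟨h3, h4, h5⟩ | ⟨h3, h4, h5⟩⟩ :=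
    hT.exists_conflict (leftmost T t) i hi (by omega) hn
  · rcases lt_trichotomy d t with h6 | rfl | h6
    · have := hT.compat c d _ t hcd hmem h3 h6; omega
    · have := leftmost_le hcd; omega
    · have := hgap d h6 h4
      have := leftmost_le hcd
      omega
  · have := hT.compat _ i c d hli hcd (by omega) h4
    omega

/-! #### Flips -/

/-- A conflict of the new corner `(x, y)` from the southwest would already be one of `(x, y')`. From
the northeast, the nodes `(x', y)` and `(x, y')` confine the other node to the rectangle, where
minimality of the rectangle and the node `(x', y')` leave no room. -/
theorem left_flip_compat (hT : IsFacet n W T) (hW : IsShape n W) {x y x' y' : ℕ} (hx : x < x')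
    (hy : y < y') (hq : (x', y') ∈ T) (hp : (x, y') ∈ T) (hr : (x', y) ∈ T)
    (hrow : ∀ a, x < a → a < x' → (a, y') ∉ T) (hcol : ∀ b, y < b → b < y' → (x', b) ∉ T)
    {c d : ℕ} (hcd : (c, d) ∈ T) (hne : (c, d) ≠ (x', y')) :
    (c < x → d < y → W d < x) ∧ (x < c → y < d → W y < c) := by
  obtain ⟨hy'n, hx'y'⟩ := hT.above _ _ hq
  obtain ⟨hyn, hx'y⟩ := hT.above _ _ hr
  constructor
  · intro h1 h2
    exact hT.compat c d x y' hcd hp h1 (by omega)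
  · intro h1 h2
    by_contra h3
    have hc : c ≤ x' := by
      by_contra h4
      have := hT.compat x' y c d hr hcd (by omega) h2
      omega
    have hd : d ≤ y' := by
      by_contra h4
      have := hT.compat x y' c d hp hcd h1 (by omega)
      have := hW.le hy.le hy'n
      omega
    rcases hd.eq_or_lt with rfl | hd
    · rcases hc.eq_or_lt with rfl | hc
      · exact hne rfl
      · exact hrow c h1 hc hcd
    · rcases hc.eq_or_lt with rfl | hc
      · exact hcol d h2 hd hcd
      · have := hT.compat c d x' y' hcd hq hc hd
        have := hW.le h2.le (by omega)
        omega

theorem right_flip_compat (hT : IsFacet n W T) {x y x' y' : ℕ} (hx : x < x')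
    (hq : (x, y) ∈ T) (hp : (x, y') ∈ T) (hr : (x', y) ∈ T)
    (hrow : ∀ a, x < a → a < x' → (a, y) ∉ T) (hcol : ∀ b, y < b → b < y' → (x, b) ∉ T)
    {c d : ℕ} (hcd : (c, d) ∈ T) (hne : (c, d) ≠ (x, y)) :
    (c < x' → d < y' → W d < x') ∧ (x' < c → y' < d → W y' < c) := by
  obtain ⟨hy'n, hxy'⟩ := hT.above _ _ hp
  obtain ⟨hyn, hx'y⟩ := hT.above _ _ hr
  constructor
  · intro h1 h2
    by_contra h3
    have hc : x ≤ c := by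
      by_contra h4
      have := hT.compat c d x y' hcd hp (by omega) h2
      omega
    have hd : y ≤ d := by
      by_contra h4
      have := hT.compat c d x' y hcd hr h1 (by omega)
      omega
    rcases hd.eq_or_lt with rfl | hd
    · rcases hc.eq_or_lt with rfl | hc
      · exact hne rfl
      · exact hrow c hc h1 hcd
    · rcases hc.eq_or_lt with rfl | hc
      · exact hcol d hd h2 hcd
      · have := hT.compat x y c d hq hcd hc hd
        omega
  · intro h1 h2
    exact hT.compat x y' c d hp hcd (by omega) h2

/-- The left rotation of a facet is a facet. -/
theorem left_flip (hT : IsFacet n W T) (hW : IsShape n W) {x y x' y' : ℕ} (hx : x < x')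
    (hy : y < y') (hq : (x', y') ∈ T) (hp : (x, y') ∈ T) (hr : (x', y) ∈ T)
    (hrow : ∀ a, x < a → a < x' → (a, y') ∉ T) (hcol : ∀ b, y < b → b < y' → (x', b) ∉ T) :
    IsFacet n W (insert (x, y) (T.erase (x', y'))) := by
  obtain ⟨hy'n, hx'y'⟩ := hT.above _ _ hq
  obtain ⟨hyn, hx'y⟩ := hT.above _ _ hr
  have key := fun c d => hT.left_flip_compat hW hx hy hq hp hr hrow hcol (c := c) (d := d)
  have hmem : ∀ c d, (c, d) ∈ T → (c, d) ≠ (x', y') →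
      (c, d) ∈ insert (x, y) (T.erase (x', y')) := fun c d h1 h2 =>
    Finset.mem_insert_of_mem (Finset.mem_erase.mpr ⟨h2, h1⟩)
  refine ⟨⟨?_, ?_⟩, ?_⟩
  · intro a b hab
    rcases Finset.mem_insert.mp hab with h | h
    · simp only [Prod.mk.injEq] at h
      obtain ⟨rfl, rfl⟩ := h
      exact ⟨hyn, by omega⟩
    · exact hT.above a b (Finset.mem_of_mem_erase h)
  · intro a b c d hab hcd hac hbd
    rcases Finset.mem_insert.mp hab with h | h
    · rcases Finset.mem_insert.mp hcd with h' | h'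
      · simp only [Prod.mk.injEq] at h h'
        omega
      · simp only [Prod.mk.injEq] at h
        obtain ⟨rfl, rfl⟩ := h
        exact (key c d (Finset.mem_of_mem_erase h') (Finset.ne_of_mem_erase h')).2 hac hbd
    · rcases Finset.mem_insert.mp hcd with h' | h'
      · simp only [Prod.mk.injEq] at h'
        obtain ⟨rfl, rfl⟩ := h'
        exact (key a b (Finset.mem_of_mem_erase h) (Finset.ne_of_mem_erase h)).1 hac hbd
      · exact hT.compat a b c d (Finset.mem_of_mem_erase h) (Finset.mem_of_mem_erase h') hac hbd
  · intro u s hs hu hus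
    have hus1 : (u, s) ≠ (x, y) := fun h => hus (h ▸ Finset.mem_insert_self _ _)
    have hus2 : (u, s) ∈ T → (u, s) = (x', y') := fun h => by
      by_contra h'
      exact hus (hmem u s h h')
    by_cases husT : (u, s) ∈ T
    · have := hus2 husT
      simp only [Prod.mk.injEq] at this
      exact ⟨x, y, Finset.mem_insert_self _ _, Or.inl ⟨by omega, by omega, by omega⟩⟩
    obtain ⟨c, d, hcd, hc⟩ := hT.exists_conflict u s hs hu husT
    by_cases hcq : (c, d) = (x', y')
    swap
    · exact ⟨c, d, hmem c d hcd hcq, hc⟩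
    simp only [Prod.mk.injEq] at hcq
    obtain ⟨rfl, rfl⟩ := hcq
    rcases hc with ⟨h1, h2, h3⟩ | ⟨h1, h2, h3⟩
    · exact ⟨x, d, hmem x d hp (by simp; omega), Or.inl ⟨by omega, h2, h3⟩⟩
    rcases lt_or_ge u x with hux | hux
    · exact ⟨x, d, hmem x d hp (by simp; omega), Or.inr ⟨hux, h2, by omega⟩⟩
    rcases lt_or_ge s y with hsy | hsy
    · exact ⟨c, y, hmem c y hr (by simp; omega), Or.inr ⟨by omega, hsy, h3⟩⟩
    have hWy := hW.le hsy (by omega)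
    have hWs := hW.le h2.le hy'n
    -- Here `(u, s)` lies in the rectangle and conflicts in `T` with the removed corner. A
    -- replacement conflict is borrowed from an absent point on the sides of the rectangle: from
    -- `(x', s)` if `u = x`, and from `(u, y')` otherwise.
    rcases hux.eq_or_lt with rfl | hux
    · have hsy : y < s := lt_of_le_of_ne hsy fun e => hus1 (by rw [e])
      obtain ⟨a, b, hab, ⟨g1, g2, g3⟩ | ⟨g1, g2, g3⟩⟩ :=
        hT.exists_conflict c s hs h3 (hcol s hsy h2)
      · have := hT.compat a b c d hab hcd g1 (by omega)
        omega
      · exact ⟨a, b, hmem a b hab (by simp; omega), Or.inr ⟨by omega, g2, g3⟩⟩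
    · obtain ⟨a, b, hab, ⟨g1, g2, g3⟩ | ⟨g1, g2, g3⟩⟩ :=
        hT.exists_conflict u d hy'n (by omega) (hrow u hux h1)
      · rcases lt_or_ge b s with hbs | hbs
        · exact ⟨a, b, hmem a b hab (by simp; omega), Or.inl ⟨g1, hbs, g3⟩⟩
        · have := hT.compat a b c d hab hcd (by omega) g2
          have := hW.le hbs (by omega)
          omega
      · have := hT.compat x d a b hp hab (by omega) g2
        omega

/-- A node, other than the root, that is neither alone in its row nor alone in its column can be
exchanged. -/
theorem exists_flip (hT : IsFacet n W T) (hW : IsShape n W) {x y : ℕ} (hxy : (x, y) ∈ T)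
    (hroot : (x, y) ≠ (0, n)) (hrow : ∃ a, (a, y) ∈ T ∧ a ≠ x) (hcol : ∃ b, (x, b) ∈ T ∧ b ≠ y) :
    ∃ u s, (u, s) ∉ T ∧ IsFace n W (insert (u, s) (T.erase (x, y))) := by
  have hface : ∀ u s, s ≤ n → u ≤ W s → (∀ c d, (c, d) ∈ T → (c, d) ≠ (x, y) →
      (c < u → d < s → W d < u) ∧ (u < c → s < d → W s < c)) →
      IsFace n W (insert (u, s) (T.erase (x, y))) := by
    intro u s hs hu key
    refine ⟨?_, ?_⟩
    · intro a b hab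
      rcases Finset.mem_insert.mp hab with h | h
      · simp only [Prod.mk.injEq] at h
        obtain ⟨rfl, rfl⟩ := h
        exact ⟨hs, hu⟩
      · exact hT.above a b (Finset.mem_of_mem_erase h)
    · intro a b c d hab hcd hac hbd
      rcases Finset.mem_insert.mp hab with h | h
      · rcases Finset.mem_insert.mp hcd with h' | h'
        · simp only [Prod.mk.injEq] at h h'
          omega
        · simp only [Prod.mk.injEq] at h
          obtain ⟨rfl, rfl⟩ := h
          exact (key c d (Finset.mem_of_mem_erase h') (Finset.ne_of_mem_erase h')).2 hac hbd
      · rcases Finset.mem_insert.mp hcd with h' | h'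
        · simp only [Prod.mk.injEq] at h'
          obtain ⟨rfl, rfl⟩ := h'
          exact (key a b (Finset.mem_of_mem_erase h) (Finset.ne_of_mem_erase h)).1 hac hbd
        · exact hT.compat a b c d (Finset.mem_of_mem_erase h) (Finset.mem_of_mem_erase h') hac hbd
  obtain ⟨hyn, hxW⟩ := hT.above _ _ hxy
  obtain ⟨a, ha, hax⟩ := hrow
  obtain ⟨b, hb, hby⟩ := hcol
  -- A node to the north excludes nodes to the west, so the other node of the row lies to the east
  -- and the rotation goes up; in the remaining case the other node of the column lies to the south
  -- and the rotation goes down.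
  rcases hT.north_or_west hxy hroot with ⟨d, hd, hxd⟩ | ⟨c, hc, hcy⟩
  · have hxa : x < a := by
      by_contra h
      exact hT.not_north_and_west hxy hxd hd ha (by omega)
    obtain ⟨d, hd, hxd, hd'⟩ := exists_nearest_above (P := fun d => (x, d) ∈ T) hxd hd
    obtain ⟨a, hxa, ha, ha'⟩ := exists_nearest_above (P := fun a => (a, y) ∈ T) ha hxa
    obtain ⟨hdn, hxd'⟩ := hT.above _ _ hxd
    obtain ⟨-, haW⟩ := hT.above _ _ ha
    have := hW.le hd.le hdn
    refine ⟨a, d, fun h => ?_, hface a d hdn (by omega) fun c e hce hne =>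
      hT.right_flip_compat hxa hxy hxd ha ha' hd' hce hne⟩
    have := hT.compat x y a d hxy h hxa hd
    omega
  · have hby' : b < y := by
      by_contra h
      exact hT.not_north_and_west hxy hb (by omega) hcy hc
    obtain ⟨b, hby', hb, hb'⟩ := exists_nearest_below (P := fun d => (x, d) ∈ T) hb hby'
    obtain ⟨c, hc, hcy, hc'⟩ := exists_nearest_below (P := fun a => (a, y) ∈ T) hcy hc
    obtain ⟨hbn, hbW⟩ := hT.above _ _ hb
    refine ⟨c, b, fun h => ?_, hface c b hbn (by omega) fun c e hce hne =>
      hT.left_flip_compat hW hc hby' hxy hcy hb hc' hb' hce hne⟩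
    have := hT.compat c b x y h hxy hc hby'
    omega

end IsFacet

/-! ### Facets as maximal faces -/

theorem isFacet_iff_maximal {n : ℕ} {W : ℕ → ℕ} {T : Finset (ℕ × ℕ)} :
    IsFacet n W T ↔ Maximal (IsFace n W) T := by
  constructor
  · exact fun hT => ⟨hT.toIsFace, fun T' hT' hsub => (hT.eq_of_subset hT' hsub).le⟩
  · rintro ⟨h1, h2⟩
    refine ⟨h1, fun a b hb ha hab => ?_⟩
    by_contra! hno
    have : IsFace n W (insert (a, b) T) := by
      refine ⟨fun c d hcd => ?_, fun c d e f hcd hef hce hdf => ?_⟩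
      · rcases Finset.mem_insert.mp hcd with h | h
        · simp only [Prod.mk.injEq] at h
          obtain ⟨rfl, rfl⟩ := h
          exact ⟨hb, ha⟩
        · exact h1.above c d h
      · rcases Finset.mem_insert.mp hcd with h | h <;> rcases Finset.mem_insert.mp hef with h' | h'
        · simp only [Prod.mk.injEq] at h h'
          omega
        · simp only [Prod.mk.injEq] at h
          obtain ⟨rfl, rfl⟩ := h
          exact (hno e f h').2 hce hdf
        · simp only [Prod.mk.injEq] at h'
          obtain ⟨rfl, rfl⟩ := h'
          exact (hno c d h).1 hce hdf
        · exact h1.compat c d e f h h' hce hdf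
    exact hab (h2 this (Finset.subset_insert _ _) (Finset.mem_insert_self _ _))

theorem finite_isFace {n : ℕ} {W : ℕ → ℕ} (hW : IsShape n W) : {I | IsFace n W I}.Finite := by
  refine ((Finset.range (W n + 1) ×ˢ Finset.range (n + 1)).powerset).finite_toSet.subset ?_
  intro I hI
  rw [Finset.mem_coe, Finset.mem_powerset]
  rintro ⟨a, b⟩ hab
  obtain ⟨h1, h2⟩ := hI.above a b hab
  have := hW.le h1 le_rfl
  simp only [Finset.mem_product, Finset.mem_range]
  omega

theorem IsFace.exists_isFacet {n : ℕ} {W : ℕ → ℕ} {I : Finset (ℕ × ℕ)} (hI : IsFace n W I)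
    (hW : IsShape n W) : ∃ T, IsFacet n W T ∧ I ⊆ T := by
  obtain ⟨T, hIT, hT⟩ := (finite_isFace hW).exists_le_maximal (a := I) hI
  exact ⟨T, isFacet_iff_maximal.mpr hT, hIT⟩

/-! #### Interior faces -/

/-- A face that is contained in no codimension-one face which lies in only one facet. -/
structure IsInterior (n : ℕ) (W : ℕ → ℕ) (I : Finset (ℕ × ℕ)) : Prop where
  face : IsFace n W I
  exists_flip : ∀ T, IsFacet n W T → ∀ q ∈ T, I ⊆ T.erase q →
    ∃ T', IsFacet n W T' ∧ T' ≠ T ∧ T.erase q ⊆ T'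

theorem IsFacet.notMem_of_erase_subset {n : ℕ} {W : ℕ → ℕ} {T T' : Finset (ℕ × ℕ)}
    (hT : IsFacet n W T) (hT' : IsFacet n W T') (hne : T' ≠ T) {q : ℕ × ℕ}
    (hsub : T.erase q ⊆ T') : q ∉ T' := by
  intro hq
  refine hne (hT.eq_of_subset hT'.toIsFace fun p hp => ?_)
  by_cases hpq : p = q
  · exact hpq ▸ hq
  · exact hsub (Finset.mem_erase.mpr ⟨hpq, hp⟩)

namespace IsInterior

variable {n : ℕ} {W : ℕ → ℕ} {I : Finset (ℕ × ℕ)}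

theorem exists_notMem (hI : IsInterior n W I) {T : Finset (ℕ × ℕ)} (hT : IsFacet n W T)
    (hIT : I ⊆ T) {q : ℕ × ℕ} (hq : q ∈ T) (hqI : q ∉ I) :
    ∃ T', IsFacet n W T' ∧ T' ≠ T ∧ T.erase q ⊆ T' ∧ I ⊆ T' ∧ q ∉ T' := by
  have h : I ⊆ T.erase q := fun p hp => Finset.mem_erase.mpr ⟨fun e => hqI (e ▸ hp), hIT hp⟩
  obtain ⟨T', hT', hne, hsub⟩ := hI.exists_flip T hT q hq h
  exact ⟨T', hT', hne, hsub, h.trans hsub, hT.notMem_of_erase_subset hT' hne hsub⟩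

theorem mem_of_forall (hI : IsInterior n W I) (hW : IsShape n W) {p : ℕ × ℕ}
    (hp : ∀ T, IsFacet n W T → p ∈ T) : p ∈ I := by
  obtain ⟨T, hT, hIT⟩ := hI.face.exists_isFacet hW
  by_contra hpI
  obtain ⟨T', hT', -, -, -, h⟩ := hI.exists_notMem hT hIT (hp T hT) hpI
  exact h (hp T' hT')

theorem root_mem (hI : IsInterior n W I) (hW : IsShape n W) : (0, n) ∈ I :=
  hI.mem_of_forall hW fun _ hT => hT.root_mem

theorem end_mem (hI : IsInterior n W I) (hW : IsShape n W) {h : ℕ} (hh : h ≤ n) : (W h, h) ∈ I :=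
  hI.mem_of_forall hW fun _ hT => hT.end_mem hW hh

/-- Suppose `I` misses column `x`, and take a facet containing `I` with as few nodes in this column
as possible. If there are several, the top one has a node to its west and can be rotated left out of
the column. If there is only one, exchanging it must produce a node in the same column; but that
point conflicts with a node of `T` other than the exchanged one, and this node survives. -/
theorem exists_mem_column (hI : IsInterior n W I) (hW : IsShape n W) {x : ℕ} (hx : x ≤ W n) :
    ∃ h, (x, h) ∈ I := by
  by_contra! hno
  have hex : ∃ m, ∃ T, IsFacet n W T ∧ I ⊆ T ∧ (T.filter (fun p => p.1 = x)).card = m := by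
    obtain ⟨T, hT, hIT⟩ := hI.face.exists_isFacet hW
    exact ⟨_, T, hT, hIT, rfl⟩
  classical
  obtain ⟨⟨T, hT, hIT, hcard⟩, hmin⟩ := And.intro (Nat.find_spec hex)
    (fun m (hm : m < Nat.find hex) => Nat.find_min hex hm)
  rw [← hcard] at hmin
  obtain ⟨h0, h0T⟩ := hT.exists_mem_column hW hx
  obtain ⟨⟨x', h⟩, hxh, hmax⟩ := (T.filter (fun p => p.1 = x)).exists_max_image Prod.snd
    ⟨_, Finset.mem_filter.mpr ⟨h0T, rfl⟩⟩
  obtain ⟨hxT, rfl⟩ := Finset.mem_filter.mp hxh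
  simp only at hno hmax hmin hx hxT h0T
  have htop : ∀ d, (x', d) ∈ T → d ≤ h := fun d hd => hmax _ (Finset.mem_filter.mpr ⟨hd, rfl⟩)
  by_cases hsole : ∀ d, (x', d) ∈ T → d = h
  · obtain ⟨T', hT', hne, hsub, -, hnot⟩ := hI.exists_notMem hT hIT hxT (hno h)
    obtain ⟨s, hs⟩ := hT'.exists_mem_column hW hx
    have hsT : (x', s) ∉ T := fun hsT => hnot (hsole s hsT ▸ hs)
    obtain ⟨hsn, hsW⟩ := hT'.above _ _ hs
    obtain ⟨c, d, hcd, hc⟩ := hT.exists_conflict x' s hsn hsW hsT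
    have hcd' : (c, d) ∈ T' := hsub (Finset.mem_erase.mpr ⟨by simp only [ne_eq, Prod.mk.injEq]; omega, hcd⟩)
    rcases hc with ⟨h1, h2, h3⟩ | ⟨h1, h2, h3⟩
    · have := hT'.compat c d x' s hcd' hs h1 h2
      omega
    · have := hT'.compat x' s c d hs hcd' h1 h2
      omega
  · push Not at hsole
    obtain ⟨b, hb, hbh⟩ := hsole
    have hbh' : b < h := lt_of_le_of_ne (htop b hb) hbh
    have hroot : (x', h) ≠ (0, n) := fun e => hno h (e ▸ hI.root_mem hW)
    obtain ⟨c, hc, hcT⟩ := (hT.north_or_west hxT hroot).resolve_left (by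
      rintro ⟨d, hd, hdT⟩
      have := htop d hdT
      omega)
    obtain ⟨b, hbh', hb, hb'⟩ := exists_nearest_below (P := fun d => (x', d) ∈ T) hb hbh'
    obtain ⟨c, hc, hcT, hc'⟩ := exists_nearest_below (P := fun a => (a, h) ∈ T) hcT hc
    have hflip := hT.left_flip hW hc hbh' hxT hcT hb hc' hb'
    refine hmin _ ?_ ⟨_, hflip, fun p hp => Finset.mem_insert_of_mem
      (Finset.mem_erase.mpr ⟨fun e => hno h (e ▸ hp), hIT hp⟩), rfl⟩
    rw [Finset.filter_insert, if_neg (by simp only; omega), Finset.filter_erase]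
    exact Finset.card_erase_lt_of_mem hxh

/-- A face is interior if it contains the root and the end of each row and meets all columns. -/
theorem of_mem (hW : IsShape n W) (hI : IsFace n W I) (hroot : (0, n) ∈ I)
    (hend : ∀ h ≤ n, (W h, h) ∈ I) (hcol : ∀ x ≤ W n, ∃ h, (x, h) ∈ I) : IsInterior n W I := by
  refine ⟨hI, ?_⟩
  rintro T hT ⟨x, y⟩ hq hsub
  obtain ⟨hy, hx⟩ := hT.above x y hq
  have hqI : ∀ p ∈ I, p ≠ (x, y) := fun p hp => Finset.ne_of_mem_erase (hsub hp)
  have hIT : ∀ p ∈ I, p ∈ T := fun p hp => Finset.mem_of_mem_erase (hsub hp)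
  obtain ⟨h, hh⟩ := hcol x (hx.trans (hW.le hy le_rfl))
  obtain ⟨u, s, hus, hface⟩ := hT.exists_flip hW hq (hqI _ hroot).symm
    ⟨W y, hIT _ (hend y hy), fun e => hqI _ (hend y hy) (by rw [e])⟩
    ⟨h, hIT _ hh, fun e => hqI _ hh (by rw [e])⟩
  obtain ⟨T', hT', hsub'⟩ := hface.exists_isFacet hW
  refine ⟨T', hT', fun e => hus (e ▸ hsub' (Finset.mem_insert_self _ _)), ?_⟩
  exact (Finset.subset_insert _ _).trans hsub'

end IsInterior

/-! #### The least tree -/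

/-- The tree consisting of the points on the left and on the lower boundary of the shape. -/
def minTree (n : ℕ) (W : ℕ → ℕ) : Finset (ℕ × ℕ) :=
  (Finset.range (W n + 1) ×ˢ Finset.range (n + 1)).filter
    (fun p => p.1 ≤ W p.2 ∧ (p.1 = 0 ∨ ∀ s < p.2, W s < p.1))

theorem mem_minTree {n : ℕ} {W : ℕ → ℕ} (hW : IsShape n W) {a b : ℕ} :
    (a, b) ∈ minTree n W ↔ b ≤ n ∧ a ≤ W b ∧ (a = 0 ∨ ∀ s < b, W s < a) := by
  simp only [minTree, Finset.mem_filter, Finset.mem_product, Finset.mem_range]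
  constructor
  · rintro ⟨⟨-, h1⟩, h2⟩
    exact ⟨by omega, h2⟩
  · rintro ⟨h1, h2, h3⟩
    have := hW.le h1 le_rfl
    exact ⟨⟨by omega, by omega⟩, h2, h3⟩

theorem isFacet_minTree {n : ℕ} {W : ℕ → ℕ} (hW : IsShape n W) : IsFacet n W (minTree n W) := by
  refine ⟨⟨?_, ?_⟩, ?_⟩
  · intro a b hab
    obtain ⟨h1, h2, -⟩ := (mem_minTree hW).mp hab
    exact ⟨h1, h2⟩
  · intro a b c d _ hcd hac hbd
    obtain ⟨-, -, h⟩ := (mem_minTree hW).mp hcd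
    exact (h.resolve_left (by omega)) b hbd
  · intro a b hb ha hn
    rw [mem_minTree hW] at hn
    push Not at hn
    obtain ⟨h0, s, hs, has⟩ := hn hb ha
    exact ⟨0, s, (mem_minTree hW).mpr ⟨by omega, by omega, Or.inl rfl⟩,
      Or.inl ⟨by omega, hs, has⟩⟩

/-- Among the nodes off the left and lower boundary, take the rightmost one `(a, b)` in the highest
row. This choice leaves nothing for `(0, b)` and `(a, b - 1)` to conflict with, so both are nodes;
the nearest node to the west and `(a, b - 1)` then complete the rectangle. -/
theorem IsFacet.exists_left_flip {n : ℕ} {W : ℕ → ℕ} {T : Finset (ℕ × ℕ)} (hT : IsFacet n W T)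
    (hW : IsShape n W) (hne : T ≠ minTree n W) :
    ∃ x y x' y', x < x' ∧ y < y' ∧ (x', y') ∈ T ∧ (x, y') ∈ T ∧ (x', y) ∈ T ∧
      (∀ a, x < a → a < x' → (a, y') ∉ T) ∧ (∀ b, y < b → b < y' → (x', b) ∉ T) := by
  classical
  set B := T.filter (fun p => 0 < p.1 ∧ ∃ s < p.2, p.1 ≤ W s) with hB
  have hmemB : ∀ a b s, (a, b) ∈ T → 0 < a → s < b → a ≤ W s → (a, b) ∈ B := fun a b s h1 h2 h3 h4 =>
    Finset.mem_filter.mpr ⟨h1, h2, s, h3, h4⟩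
  have hBne : B.Nonempty := by
    by_contra hemp
    apply hne
    refine (hT.eq_of_subset (isFacet_minTree hW).toIsFace fun p hp => ?_).symm
    obtain ⟨a, b⟩ := p
    obtain ⟨h1, h2⟩ := hT.above a b hp
    refine (mem_minTree hW).mpr ⟨h1, h2, ?_⟩
    by_contra! h3
    obtain ⟨h4, s, hs, has⟩ := h3
    exact hemp ⟨_, hmemB a b s hp (by omega) hs has⟩
  obtain ⟨p, hpB, hpmax⟩ := B.exists_max_image Prod.snd hBne
  obtain ⟨⟨a, b⟩, habB, habmax⟩ := (B.filter (fun q => q.2 = p.2)).exists_max_image Prod.fst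
    ⟨p, Finset.mem_filter.mpr ⟨hpB, rfl⟩⟩
  obtain ⟨habB, hbp⟩ := Finset.mem_filter.mp habB
  simp only at hbp
  rw [← hbp] at hpmax habmax
  obtain ⟨habT, ha0, s, hsb, has⟩ := Finset.mem_filter.mp habB
  simp only at ha0 hsb has
  obtain ⟨hbn, haW⟩ := hT.above a b habT
  have hno : ∀ c d s, (c, d) ∈ T → 0 < c → s < d → c ≤ W s → ¬ b < d := fun c d s h1 h2 h3 h4 h5 => by
    have := hpmax _ (hmemB c d s h1 h2 h3 h4)
    simp only at this
    omega
  have hwest : (0, b) ∈ T := by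
    by_contra h0
    obtain ⟨c, d, hcd, ⟨h1, h2, h3⟩ | ⟨h1, h2, h3⟩⟩ := hT.exists_conflict 0 b hbn (by omega) h0
    · omega
    · exact hno c d b hcd h1 h2 h3 h2
  have has' : a ≤ W (b - 1) := has.trans (hW.le (by omega) (by omega))
  have hsouth : (a, b - 1) ∈ T := by
    by_contra h0
    obtain ⟨c, d, hcd, ⟨h1, h2, h3⟩ | ⟨h1, h2, h3⟩⟩ :=
      hT.exists_conflict a (b - 1) (by omega) has' h0
    · have := hT.compat c d a b hcd habT h1 (by omega)
      omega
    · rcases (show b ≤ d by omega).eq_or_lt with rfl | h4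
      · have := habmax (c, b) (Finset.mem_filter.mpr
          ⟨hmemB c b (b - 1) hcd (by omega) (by omega) h3, rfl⟩)
        simp only at this
        omega
      · exact hno c d (b - 1) hcd (by omega) (by omega) h3 h4
  obtain ⟨x, hx, hxm, hx'⟩ := exists_nearest_below (P := fun c => (c, b) ∈ T) hwest ha0
  exact ⟨x, b - 1, a, b, hx, by omega, habT, hxm, hsouth, hx', fun c _ _ => by omega⟩

/-! ### The columns of the path from the root to the leftmost node of a row -/

/-- The column in which the path from the root to the leftmost node at height `J` passes from
height `b + 1` to height `b`. -/
noncomputable def pathColumn (T : Finset (ℕ × ℕ)) (W : ℕ → ℕ) (J b : ℕ) : ℕ :=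
  leftmost T (Nat.findGreatest (fun t => leftmost T t ≤ W J) b)

/-- The area to the left of the path from the root to the leftmost node at height `J`. -/
noncomputable def pathArea (n : ℕ) (W : ℕ → ℕ) (T : Finset (ℕ × ℕ)) (J : ℕ) : ℕ :=
  ∑ b ∈ Finset.Ico J n, pathColumn T W J b

theorem pathColumn_succ (T : Finset (ℕ × ℕ)) (W : ℕ → ℕ) (J b : ℕ) :
    pathColumn T W J (b + 1) =
      if leftmost T (b + 1) ≤ W J then leftmost T (b + 1) else pathColumn T W J b := by
  unfold pathColumn
  rw [Nat.findGreatest_succ]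
  split_ifs <;> rfl

theorem pathColumn_of_le {T : Finset (ℕ × ℕ)} {W : ℕ → ℕ} {J b : ℕ} (h : leftmost T b ≤ W J) :
    pathColumn T W J b = leftmost T b := by
  unfold pathColumn
  rw [Nat.findGreatest_eq (P := fun t => leftmost T t ≤ W J) h]

namespace IsFacet

variable {n : ℕ} {W : ℕ → ℕ} {T : Finset (ℕ × ℕ)}

theorem pathColumn_self (hT : IsFacet n W T) (hW : IsShape n W) {J : ℕ} (hJ : J ≤ n) :
    pathColumn T W J J = leftmost T J :=
  pathColumn_of_le (hT.leftmost_le_width hW hJ)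

theorem pathColumn_spec (hT : IsFacet n W T) (hW : IsShape n W) {J b : ℕ} (hJb : J ≤ b)
    (hb : b ≤ n) : ∃ t, J ≤ t ∧ t ≤ b ∧ leftmost T t ≤ W J ∧ pathColumn T W J b = leftmost T t ∧
      ∀ s, t < s → s ≤ b → W J < leftmost T s := by
  have hJ := hT.leftmost_le_width hW (h := J) (by omega)
  refine ⟨Nat.findGreatest (fun t => leftmost T t ≤ W J) b, Nat.le_findGreatest hJb hJ,
    Nat.findGreatest_le b, Nat.findGreatest_spec (P := fun t => leftmost T t ≤ W J) hJb hJ, rfl,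
    fun s h1 h2 => ?_⟩
  have := Nat.findGreatest_is_greatest h1 h2
  omega

theorem pathColumn_le (hT : IsFacet n W T) (hW : IsShape n W) {J b : ℕ} (hJb : J ≤ b)
    (hb : b ≤ n) : pathColumn T W J b ≤ W J := by
  obtain ⟨t, -, -, h, he, -⟩ := hT.pathColumn_spec hW hJb hb
  omega

theorem pathColumn_mem (hT : IsFacet n W T) (hW : IsShape n W) {J b : ℕ} (hJb : J ≤ b)
    (hb : b < n) (hl : leftmost T (b + 1) ≤ W J) :
    (pathColumn T W J b, b + 1) ∈ T ∧
      ∀ x, (x, b + 1) ∈ T → x ≤ W J → x ≤ pathColumn T W J b := by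
  obtain ⟨t, h1, h2, h3, he, h4⟩ := hT.pathColumn_spec hW hJb hb.le
  rw [he]
  exact hT.mem_of_leftmost_le hW h1 (by omega) (by omega) h3 (fun s h5 h6 => h4 s h5 (by omega)) hl

theorem pathColumn_antitone (hT : IsFacet n W T) (hW : IsShape n W) {J b b' : ℕ} (hJb : J ≤ b)
    (hbb' : b ≤ b') (hb' : b' ≤ n) : pathColumn T W J b' ≤ pathColumn T W J b := by
  induction b', hbb' using Nat.le_induction with
  | base => rfl
  | succ m hm ih =>
    refine le_trans ?_ (ih (by omega))
    rw [pathColumn_succ]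
    split_ifs with h
    · exact (hT.pathColumn_mem hW (by omega) (by omega) h).2 _ (hT.leftmost_mem hW hb') h
    · rfl

theorem pathColumn_mono (hT : IsFacet n W T) (hW : IsShape n W) {J J' b : ℕ} (hJ : J ≤ J')
    (hJb : J' ≤ b) (hb : b ≤ n) : pathColumn T W J b ≤ pathColumn T W J' b := by
  obtain ⟨t, h1, h2, h3, he, h4⟩ := hT.pathColumn_spec hW (hJ.trans hJb) hb
  obtain ⟨t', h1', h2', h3', he', h4'⟩ := hT.pathColumn_spec hW hJb hb
  have := hW.le hJ (by omega)
  rw [he, he']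
  rcases lt_trichotomy t t' with h | h | h
  · have := h4 t' h h2'
    omega
  · rw [h]
  · have := h4' t h h2
    omega

/-- If the leftmost node of row `J'` is within reach of row `J`, the two paths merge there: a later
row that only the path of `J'` could use would have its leftmost node right of `W J`, while that
path has already moved left of it. -/
theorem pathColumn_eq (hT : IsFacet n W T) (hW : IsShape n W) {J J' b : ℕ} (hJ : J ≤ J')
    (hJb : J' ≤ b) (hb : b ≤ n) (hl : leftmost T J' ≤ W J) :
    pathColumn T W J b = pathColumn T W J' b := by
  induction b, hJb using Nat.le_induction with
  | base => rw [pathColumn_of_le hl, hT.pathColumn_self hW hb]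
  | succ m hm ih =>
    have ih := ih (by omega)
    have := hW.le hJ (by omega)
    rw [pathColumn_succ, pathColumn_succ]
    split_ifs with h1 h2 h2
    · rfl
    · omega
    · have := (hT.pathColumn_mem hW hm (by omega) h2).2 _ (hT.leftmost_mem hW hb) h2
      have := hT.pathColumn_le hW (show J ≤ m by omega) (by omega)
      omega
    · exact ih

/-- Above row `h'` the path from the lower row runs weakly to the left; below `h'` its columns are
at most the leftmost node of row `h`, hence at most `x`. This is the tightness inequality of `(x,
h)` against higher rows. -/
theorem pathArea_le_of_lt (hT : IsFacet n W T) (hW : IsShape n W) {x h h' : ℕ} (hx : (x, h) ∈ T)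
    (hh : h ≤ h') (hh' : h' ≤ n) : pathArea n W T h ≤ pathArea n W T h' + x * (h' - h) := by
  unfold pathArea
  rw [← Finset.sum_Ico_consecutive _ hh hh', add_comm]
  refine Nat.add_le_add ?_ ?_
  · exact Finset.sum_le_sum fun b hb => hT.pathColumn_mono hW hh (Finset.mem_Ico.mp hb).1
      (Finset.mem_Ico.mp hb).2.le
  · calc ∑ b ∈ Finset.Ico h h', pathColumn T W h b ≤ ∑ b ∈ Finset.Ico h h', x := by
          refine Finset.sum_le_sum fun b hb => ?_
          rw [Finset.mem_Ico] at hb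
          have := hT.pathColumn_antitone hW le_rfl hb.1 (by omega)
          rw [hT.pathColumn_self hW (by omega)] at this
          exact this.trans (leftmost_le hx)
      _ = x * (h' - h) := by simp [mul_comm]

/-- Above row `h` the two paths coincide. Below it the path of row `h'` stays weakly right of the
last node of row `h` that does not exceed `W h'`, hence right of `x`. This is the tightness
inequality against lower rows. -/
theorem pathArea_ge_of_gt (hT : IsFacet n W T) (hW : IsShape n W) {x h h' : ℕ} (hx : (x, h) ∈ T)
    (hh : h' ≤ h) (hxW : x ≤ W h') : pathArea n W T h + x * (h - h') ≤ pathArea n W T h' := by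
  have hhn := (hT.above x h hx).1
  have hl : leftmost T h ≤ W h' := (leftmost_le hx).trans hxW
  unfold pathArea
  rw [← Finset.sum_Ico_consecutive _ hh hhn, add_comm]
  refine Nat.add_le_add ?_ ?_
  · calc x * (h - h') = ∑ b ∈ Finset.Ico h' h, x := by simp [mul_comm]
      _ ≤ _ := by
          refine Finset.sum_le_sum fun b hb => ?_
          rw [Finset.mem_Ico] at hb
          have h1 := hT.pathColumn_antitone hW hb.1 (show b ≤ h - 1 by omega) (by omega)
          refine le_trans ?_ h1
          have := (hT.pathColumn_mem hW (J := h') (b := h - 1) (by omega) (by omega)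
            (by rwa [Nat.sub_add_cancel (by omega)])).2 x
          rw [Nat.sub_add_cancel (by omega)] at this
          exact this hx hxW
  · exact (Finset.sum_congr rfl fun b hb => (hT.pathColumn_eq hW hh (Finset.mem_Ico.mp hb).1
      (Finset.mem_Ico.mp hb).2.le hl).symm).le

end IsFacet

theorem leftmost_minTree {n : ℕ} {W : ℕ → ℕ} (hW : IsShape n W) {h : ℕ} (hh : h ≤ n) :
    leftmost (minTree n W) h = 0 :=
  Nat.le_zero.mp (leftmost_le ((mem_minTree hW).mpr ⟨hh, by omega, Or.inl rfl⟩))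

theorem pathArea_minTree {n : ℕ} {W : ℕ → ℕ} (hW : IsShape n W) (J : ℕ) :
    pathArea n W (minTree n W) J = 0 := by
  refine Finset.sum_eq_zero fun b hb => ?_
  rw [Finset.mem_Ico] at hb
  obtain ⟨t, h1, h2, h3, he, h4⟩ := (isFacet_minTree hW).pathColumn_spec hW hb.1 hb.2.le
  rw [he, leftmost_minTree hW (by omega)]

theorem pathArea_top (n : ℕ) (W : ℕ → ℕ) (T : Finset (ℕ × ℕ)) : pathArea n W T n = 0 := by
  simp [pathArea]

theorem pathArea_zero {n : ℕ} {W : ℕ → ℕ} {T : Finset (ℕ × ℕ)} (hT : IsFacet n W T)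
    (hW : IsShape n W) : pathArea n W T 0 = 0 := by
  refine Finset.sum_eq_zero fun b hb => ?_
  have := hT.pathColumn_le hW (Nat.zero_le b) (Finset.mem_Ico.mp hb).2.le
  rw [hW.zero] at this
  omega

/-! ### The tree graph of a facet -/

/-- A walk all of whose steps lead to the next node in north or west direction. -/
def IsDescending {T : Finset (ℕ × ℕ)} {u v : ℕ × ℕ} (P : (treeGraph T).Walk u v) : Prop :=
  ∀ d ∈ P.darts, IsNextNode T d.fst d.snd

theorem IsDescending.head {T : Finset (ℕ × ℕ)} {u v w : ℕ × ℕ} {h : (treeGraph T).Adj u v}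
    {P : (treeGraph T).Walk v w} (hP : IsDescending (P.cons h)) : IsNextNode T u v :=
  hP ⟨(u, v), h⟩ (by simp)

theorem IsDescending.tail {T : Finset (ℕ × ℕ)} {u v w : ℕ × ℕ} {h : (treeGraph T).Adj u v}
    {P : (treeGraph T).Walk v w} (hP : IsDescending (P.cons h)) : IsDescending P :=
  fun d hd => hP d (by simp [hd])

namespace IsFacet

variable {n : ℕ} {W : ℕ → ℕ} {T : Finset (ℕ × ℕ)}

theorem nextNode_unique (hT : IsFacet n W T) {p q q' : ℕ × ℕ} (hq : IsNextNode T p q)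
    (hq' : IsNextNode T p q') : q = q' := by
  obtain ⟨p1, p2⟩ := p
  obtain ⟨q1, q2⟩ := q
  obtain ⟨r1, r2⟩ := q'
  obtain ⟨hp, hq, ⟨h1, h2, h3⟩ | ⟨h1, h2, h3⟩⟩ := hq <;>
    obtain ⟨-, hr, ⟨g1, g2, g3⟩ | ⟨g1, g2, g3⟩⟩ := hq' <;> simp only at h1 h2 g1 g2
  · have h4 := h3 _ hr g1 g2
    have h5 := g3 _ hq h1 h2
    simp only [Prod.mk.injEq] at *
    omega
  · subst h1 g1
    exact (hT.not_north_and_west hp hq h2 hr g2).elim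
  · subst h1 g1
    exact (hT.not_north_and_west hp hr g2 hq h2).elim
  · have h4 := h3 _ hr g1 g2
    have h5 := g3 _ hq h1 h2
    simp only [Prod.mk.injEq] at *
    omega

theorem not_nextNode_root (hT : IsFacet n W T) {q : ℕ × ℕ} (hq : IsNextNode T (0, n) q) :
    False := by
  obtain ⟨-, hq, ⟨-, h2, -⟩ | ⟨-, h2, -⟩⟩ := hq
  · have := (hT.above _ _ hq).1
    simp only at h2
    omega
  · simp only at h2
    omega

/-- By induction from the root end: if the first step went against the direction, the next step,
being the unique one available, would return to the start; and the root has no next node. -/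
theorem isDescending_of_isPath (hT : IsFacet n W T) {u : ℕ × ℕ}
    {P : (treeGraph T).Walk u (0, n)} (hP : P.IsPath) : IsDescending P := by
  generalize hv : ((0, n) : ℕ × ℕ) = v at P
  induction P with
  | nil => intro d hd; simp at hd
  | @cons u w v h p ih =>
    subst hv
    rw [SimpleGraph.Walk.cons_isPath_iff] at hP
    have hp := ih rfl hP.1
    intro d hd
    rw [SimpleGraph.Walk.darts_cons, List.mem_cons] at hd
    rcases hd with rfl | hd
    · rcases h with h | h
      · exact h
      · exfalso
        cases p with
        | nil => exact hT.not_nextNode_root h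
        | cons h' p' =>
          have := hT.nextNode_unique h hp.head
          apply hP.2
          simp [this]
    · exact hp d hd

theorem isDescending_unique (hT : IsFacet n W T) {u : ℕ × ℕ}
    {P Q : (treeGraph T).Walk u (0, n)} (hP : IsDescending P) (hQ : IsDescending Q) : P = Q := by
  generalize hv : ((0, n) : ℕ × ℕ) = v at P Q
  induction P with
  | nil =>
    subst hv
    cases Q with
    | nil => rfl
    | cons h q => exact (hT.not_nextNode_root hQ.head).elim
  | cons h p ih =>
    subst hv
    cases Q with
    | nil => exact (hT.not_nextNode_root hP.head).elim
    | cons h' q =>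
      obtain rfl := hT.nextNode_unique hP.head hQ.head
      rw [ih rfl hP.tail hQ.tail]

/-- Paths to the root are descending and hence unique. Every walk shortens to a path, and a shortest
walk is itself a path. -/
theorem shortestWalk_of_isDescending (hT : IsFacet n W T) {u : ℕ × ℕ}
    {P : (treeGraph T).Walk u (0, n)} (hP : IsDescending P) :
    IsShortestWalk P.reverse ∧ ∀ Q, IsShortestWalk Q → Q = P.reverse := by
  have huniq : ∀ Q : (treeGraph T).Walk (0, n) u, Q.IsPath → Q = P.reverse := by
    intro Q hQ
    have h := hT.isDescending_unique (hT.isDescending_of_isPath hQ.reverse) hP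
    rw [← h, SimpleGraph.Walk.reverse_reverse]
  have hshort : ∀ Q : (treeGraph T).Walk (0, n) u, P.reverse.length ≤ Q.length := by
    intro Q
    classical
    rw [← huniq Q.bypass Q.bypass_isPath]
    exact Q.length_bypass_le_length
  refine ⟨hshort, fun Q hQ => huniq Q ?_⟩
  classical
  refine SimpleGraph.Walk.isPath_of_length_eq_dist _ ?_
  refine le_antisymm ?_ (SimpleGraph.dist_le Q)
  obtain ⟨R, hR⟩ := Q.reachable.exists_walk_length_eq_dist
  rw [← hR]
  exact hQ R

theorem exists_horizontal_walk (hT : IsFacet n W T) (hW : IsShape n W) {x h : ℕ}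
    (hx : (x, h) ∈ T) : ∃ P : (treeGraph T).Walk (x, h) (leftmost T h, h), IsDescending P ∧
      ∀ d ∈ P.darts, d.fst.1 ≠ d.snd.1 := by
  induction x using Nat.strong_induction_on with
  | _ x ih =>
    have hhn := (hT.above x h hx).1
    rcases (leftmost_le hx).eq_or_lt with he | hlt
    · rw [he]
      exact ⟨.nil, by simp [IsDescending], by simp⟩
    · obtain ⟨c, hc, hcT, hc'⟩ := exists_nearest_below (P := fun c => (c, h) ∈ T)
        (hT.leftmost_mem hW hhn) hlt
      obtain ⟨P, hP, hP'⟩ := ih c hc hcT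
      have hnext : IsNextNode T (x, h) (c, h) := by
        refine ⟨hx, hcT, Or.inr ⟨rfl, hc, ?_⟩⟩
        rintro ⟨z, b⟩ hz rfl h2
        by_contra hlt
        exact hc' z (by simpa using hlt) h2 hz
      have hadj : (treeGraph T).Adj (x, h) (c, h) := Or.inl hnext
      refine ⟨.cons hadj P, ?_, ?_⟩
      · intro d hd
        rw [SimpleGraph.Walk.darts_cons, List.mem_cons] at hd
        rcases hd with rfl | hd
        · exact hnext
        · exact hP d hd
      · intro d hd
        rw [SimpleGraph.Walk.darts_cons, List.mem_cons] at hd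
        rcases hd with rfl | hd
        · simp only; omega
        · exact hP' d hd

/-- From a leftmost node the walk goes north to the next node of the column, in row `m`, then west
to the leftmost node of row `m`, and recursively on. A row strictly between `J` and `m` cannot
change the column, as `pathColumn_mem` would put a node of that row into the column before `m`. -/
theorem exists_descending_walk (hT : IsFacet n W T) (hW : IsShape n W) {J : ℕ} (hJ : J ≤ n) :
    ∃ P : (treeGraph T).Walk (leftmost T J, J) (0, n), IsDescending P ∧ ∀ a b,
      (∃ d ∈ P.darts, d.fst.1 = d.snd.1 ∧ a < d.fst.1 ∧ min d.fst.2 d.snd.2 ≤ b ∧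
        b < max d.fst.2 d.snd.2) ↔ J ≤ b ∧ b < n ∧ a < pathColumn T W J b := by
  induction hk : n - J using Nat.strong_induction_on generalizing J with
  | _ k ih =>
    rcases hJ.eq_or_lt with rfl | hJn
    · rw [hT.leftmost_top]
      refine ⟨.nil, by simp [IsDescending], fun a b => ?_⟩
      simp only [SimpleGraph.Walk.darts_nil, List.not_mem_nil, false_and, exists_false, false_iff]
      omega
    · have hl := hT.leftmost_mem hW hJ
      have hN : ∃ d, J < d ∧ (leftmost T J, d) ∈ T := by
        refine (hT.north_or_west hl (by simp; omega)).resolve_right ?_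
        rintro ⟨c, hc, hcT⟩
        have := leftmost_le hcT
        omega
      obtain ⟨d, hd, hdT⟩ := hN
      obtain ⟨m, hJm, hmT, hm⟩ := exists_nearest_above (P := fun d => (leftmost T J, d) ∈ T) hdT hd
      have hmn := (hT.above _ _ hmT).1
      obtain ⟨P, hP, hP'⟩ := ih (n - m) (by omega) hmn rfl
      obtain ⟨Q, hQ, hQ'⟩ := hT.exists_horizontal_walk hW hmT
      have hnext : IsNextNode T (leftmost T J, J) (leftmost T J, m) := by
        refine ⟨hl, hmT, Or.inl ⟨rfl, hJm, ?_⟩⟩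
        rintro ⟨z, b⟩ hz rfl h2
        by_contra hlt
        exact hm b h2 (by simpa using hlt) hz
      have hlJ := hT.leftmost_le_width hW hJ
      have hlow : ∀ b, J ≤ b → b < m → pathColumn T W J b = leftmost T J := by
        intro b hb
        induction b, hb using Nat.le_induction with
        | base => exact fun _ => hT.pathColumn_self hW hJ
        | succ b hb ihb =>
          intro hbm
          have ihb := ihb (by omega)
          rw [pathColumn_succ, if_neg, ihb]
          intro h
          have := (hT.pathColumn_mem hW hb (by omega) h).1
          rw [ihb] at this
          exact hm _ (by omega) hbm this
      have hhigh : ∀ b, m ≤ b → b < n → pathColumn T W J b = pathColumn T W m b :=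
        fun b h1 h2 => hT.pathColumn_eq hW hJm.le h1 h2.le ((leftmost_le hmT).trans hlJ)
      have hadj : (treeGraph T).Adj (leftmost T J, J) (leftmost T J, m) := Or.inl hnext
      refine ⟨.cons hadj (Q.append P), ?_, fun a b => ?_⟩
      · intro d hd
        rw [SimpleGraph.Walk.darts_cons, List.mem_cons, SimpleGraph.Walk.darts_append,
          List.mem_append] at hd
        rcases hd with rfl | hd | hd
        · exact hnext
        · exact hQ d hd
        · exact hP d hd
      · rw [SimpleGraph.Walk.darts_cons, SimpleGraph.Walk.darts_append]
        simp only [List.mem_cons, List.mem_append, or_and_right, exists_or, exists_eq_left]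
        rw [hP']
        constructor
        · rintro (⟨-, h1, h2, h3⟩ | ⟨d, hd, h1, -⟩ | ⟨h1, h2, h3⟩)
          · rw [min_eq_left hJm.le] at h2
            rw [max_eq_right hJm.le] at h3
            exact ⟨h2, by omega, by rwa [hlow b h2 h3]⟩
          · exact (hQ' d hd h1).elim
          · exact ⟨by omega, h2, by rwa [hhigh b h1 h2]⟩
        · rintro ⟨h1, h2, h3⟩
          rcases lt_or_ge b m with hbm | hbm
          · rw [hlow b h1 hbm] at h3
            left
            rw [min_eq_left hJm.le, max_eq_right hJm.le]
            exact ⟨trivial, h3, h1, hbm⟩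
          · rw [hhigh b hbm h2] at h3
            exact Or.inr (Or.inr ⟨hbm, h2, h3⟩)

/-- The path from the root to the leftmost node of a row, and its area. -/
theorem exists_shortestWalk (hT : IsFacet n W T) (hW : IsShape n W) {ν : List PathStep}
    (hheight : pathHeight ν = n) (hwidth : pathWidth ν = W n) {J : ℕ} (hJ : J ≤ n) :
    ∃ P : (treeGraph T).Walk (nuRoot ν) (leftmost T J, J), IsShortestWalk P ∧
      (∀ P', IsShortestWalk P' → P' = P) ∧ walkArea ν P = pathArea n W T J := by
  subst hheight
  obtain ⟨P, hP, hP'⟩ := hT.exists_descending_walk hW hJ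
  obtain ⟨h1, h2⟩ := hT.shortestWalk_of_isDescending hP
  suffices h : walkArea ν P.reverse = pathArea (pathHeight ν) W T J from ⟨P.reverse, h1, h2, h⟩
  have hrev : ∀ a b, (∃ d ∈ P.reverse.darts, d.fst.1 = d.snd.1 ∧ a < d.fst.1 ∧
      min d.fst.2 d.snd.2 ≤ b ∧ b < max d.fst.2 d.snd.2) ↔
      J ≤ b ∧ b < pathHeight ν ∧ a < pathColumn T W J b := by
    intro a b
    rw [← hP' a b]
    constructor
    · rintro ⟨d, hd, h3, h4, h5, h6⟩
      rw [SimpleGraph.Walk.mem_darts_reverse] at hd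
      exact ⟨d.symm, hd, h3.symm, by simpa [← h3] using h4, by simpa [min_comm] using h5,
        by simpa [max_comm] using h6⟩
    · rintro ⟨d, hd, h3, h4, h5, h6⟩
      refine ⟨d.symm, ?_, h3.symm, by simpa [← h3] using h4, by simpa [min_comm] using h5,
        by simpa [max_comm] using h6⟩
      rw [SimpleGraph.Walk.mem_darts_reverse]
      simpa using hd
  unfold walkArea pathArea
  simp only [hrev]
  rw [Finset.card_filter, Finset.sum_product_right, hwidth]
  have hsub : Finset.Ico J (pathHeight ν) ⊆ Finset.range (pathHeight ν) := fun b hb => by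
    simp only [Finset.mem_Ico, Finset.mem_range] at *
    omega
  rw [← Finset.sum_subset hsub]
  · refine Finset.sum_congr rfl fun b hb => ?_
    rw [Finset.mem_Ico] at hb
    have h3 := hT.pathColumn_le hW hb.1 hb.2.le
    have h4 := hW.le hJ le_rfl
    rw [← Finset.card_filter]
    trans (Finset.range (pathColumn T W J b)).card
    · congr 1
      ext a
      simp only [Finset.mem_filter, Finset.mem_range]
      omega
    · simp
  · intro b _ hb
    rw [Finset.mem_Ico] at hb
    refine Finset.sum_eq_zero fun a _ => if_neg ?_
    simp only
    tauto

end IsFacet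

/-! ### Pipes -/

/-- Crossing the pipes in positions `a` and `a + 1`. -/
def crossPipes (f : ℕ → ℕ) (a : ℕ) : ℕ → ℕ := f ∘ Equiv.swap a (a + 1)

/-- The order in which the points are read: by columns, each of them from bottom to top. -/
abbrev ReadBefore (p q : ℕ × ℕ) : Prop := p.1 < q.1 ∨ (p.1 = q.1 ∧ p.2 < q.2)

/-- The list of the points of a shape in reading order. -/
structure IsReading (n : ℕ) (W : ℕ → ℕ) (L : List (ℕ × ℕ)) : Prop where
  sorted : L.Pairwise ReadBefore
  mem_iff : ∀ a b, (a, b) ∈ L ↔ b ≤ n ∧ a ≤ W b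

/-- The labels of the pipes in all positions before the point `p` is read, where the pipes cross at
the points outside `T` and the pipe that starts in position `a` has label `f a`. -/
def pipeState (n : ℕ) (L : List (ℕ × ℕ)) (T : Finset (ℕ × ℕ)) (f : ℕ → ℕ) (p : ℕ × ℕ) : ℕ → ℕ :=
  ((L.filter (fun r => ReadBefore r p ∧ r ∉ T)).map (fun r => r.1 + (n - r.2))).foldl crossPipes f

theorem sum_crossPipes (f : ℕ → ℕ) {a c : ℕ} (h : a ≠ c) :
    ∑ i ∈ Finset.range (c + 1), crossPipes f a i = ∑ i ∈ Finset.range (c + 1), f i := by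
  rcases lt_or_gt_of_ne h with h | h
  · refine Finset.sum_equiv (Equiv.swap a (a + 1)) (fun i => ?_) (fun i _ => rfl)
    simp only [Finset.mem_range]
    by_cases h1 : i = a
    · subst h1; rw [Equiv.swap_apply_left]; omega
    · by_cases h2 : i = a + 1
      · subst h2; rw [Equiv.swap_apply_right]; omega
      · rw [Equiv.swap_apply_of_ne_of_ne h1 h2]
  · refine Finset.sum_congr rfl fun i hi => ?_
    rw [Finset.mem_range] at hi
    simp only [crossPipes, Function.comp]
    rw [Equiv.swap_apply_of_ne_of_ne (by omega) (by omega)]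

theorem sum_foldl_crossPipes {K : List ℕ} {c : ℕ} (hK : ∀ a ∈ K, a ≠ c) (f : ℕ → ℕ) :
    ∑ i ∈ Finset.range (c + 1), K.foldl crossPipes f i = ∑ i ∈ Finset.range (c + 1), f i := by
  induction K generalizing f with
  | nil => rfl
  | cons a K ih =>
    rw [List.foldl_cons, ih (fun b hb => hK b (by simp [hb])), sum_crossPipes f (hK a (by simp))]

theorem foldl_crossPipes_apply {K : List ℕ} {c : ℕ} (hK : ∀ a ∈ K, a ≠ c ∧ a + 1 ≠ c) (f : ℕ → ℕ) :
    K.foldl crossPipes f c = f c := by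
  induction K generalizing f with
  | nil => rfl
  | cons a K ih =>
    rw [List.foldl_cons, ih (fun b hb => hK b (by simp [hb]))]
    have := hK a (by simp)
    simp only [crossPipes, Function.comp]
    rw [Equiv.swap_apply_of_ne_of_ne (by omega) (by omega)]

theorem foldl_crossPipes_eq {K : List ℕ} {f : ℕ → ℕ} (hK : ∀ a ∈ K, f a = f (a + 1)) :
    K.foldl crossPipes f = f := by
  induction K with
  | nil => rfl
  | cons a K ih =>
    have h : crossPipes f a = f := by
      have h0 := hK a (by simp)
      funext i
      simp only [crossPipes, Function.comp]
      by_cases h1 : i = a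
      · subst h1; rw [Equiv.swap_apply_left, h0]
      · by_cases h2 : i = a + 1
        · subst h2; rw [Equiv.swap_apply_right, h0]
        · rw [Equiv.swap_apply_of_ne_of_ne h1 h2]
    rw [List.foldl_cons, h, ih (fun b hb => hK b (by simp [hb]))]

/-- No element satisfying `Q` precedes one satisfying `P`, so the two filtered lists are
consecutive. This cuts the history of crossings at a point. -/
theorem filter_or_of_pairwise {α : Type*} {r : α → α → Prop} {P Q : α → Prop} [DecidablePred P]
    [DecidablePred Q] {L : List α} (hL : L.Pairwise r) (h : ∀ a b, Q a → P b → ¬ r a b)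
    (hPQ : ∀ a, P a → ¬ Q a) :
    L.filter (fun a => P a ∨ Q a) = L.filter (fun a => P a) ++ L.filter (fun a => Q a) := by
  induction L with
  | nil => rfl
  | cons a L ih =>
    rw [List.pairwise_cons] at hL
    have ih := ih hL.2
    by_cases hP : P a
    · have := hPQ a hP
      simp [hP, this, ih, -Bool.decide_or]
    · by_cases hQ : Q a
      · have hnil : L.filter (fun a => P a) = [] := by
          rw [List.filter_eq_nil_iff]
          intro b hb hPb
          exact h a b hQ (by simpa using hPb) (hL.1 b hb)
        rw [hnil] at ih
        simp [hP, hQ, ih, hnil, -Bool.decide_or]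
      · simp [hP, hQ, ih, -Bool.decide_or]

namespace IsReading

variable {n : ℕ} {W : ℕ → ℕ} {L : List (ℕ × ℕ)}

theorem pipeState_split (hL : IsReading n W L) (T : Finset (ℕ × ℕ)) (f : ℕ → ℕ) {p q : ℕ × ℕ}
    (hpq : ∀ r, ReadBefore r p → ReadBefore r q) :
    pipeState n L T f q = ((L.filter (fun r => (¬ ReadBefore r p ∧ ReadBefore r q) ∧ r ∉ T)).map
      (fun r => r.1 + (n - r.2))).foldl crossPipes (pipeState n L T f p) := by
  unfold pipeState
  rw [← List.foldl_append, ← List.map_append, ← filter_or_of_pairwise hL.sorted]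
  · congr 2
    refine List.filter_congr fun r _ => ?_
    have := hpq r
    simp only [decide_eq_decide]
    tauto
  · intro a b h1 h2 h3
    refine h1.1.1 ?_
    have := h2.1
    simp only [ReadBefore] at *
    omega
  · intro a h1 h2
    exact h2.1.1 h1.1

theorem pipeState_up (hL : IsReading n W L) (T : Finset (ℕ × ℕ)) (f : ℕ → ℕ) {x h : ℕ}
    (hh : h ≤ n) (hx : x ≤ W h) : pipeState n L T f (x, h + 1) =
      if (x, h) ∈ T then pipeState n L T f (x, h)
      else crossPipes (pipeState n L T f (x, h)) (x + (n - h)) := by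
  rw [hL.pipeState_split T f (p := (x, h)) (q := (x, h + 1))
    (fun r hr => by simp only [ReadBefore] at *; omega)]
  have hfilter : L.filter (fun r => r = (x, h)) = [(x, h)] := by
    have hnodup : L.Nodup := hL.sorted.imp fun {a b} hab he => by
      subst he
      simp only [ReadBefore] at hab
      omega
    have hmem : (x, h) ∈ L := (hL.mem_iff x h).mpr ⟨hh, hx⟩
    have : L.filter (fun r => r = (x, h)) = List.replicate (L.count (x, h)) (x, h) := by
      rw [← List.filter_beq]
      exact List.filter_congr fun r _ => by rw [beq_eq_decide]
    rw [this, List.count_eq_one_of_mem hnodup hmem]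
    rfl
  have heq : ∀ r : ℕ × ℕ, (¬ ReadBefore r (x, h) ∧ ReadBefore r (x, h + 1)) ↔ r = (x, h) := by
    rintro ⟨a, b⟩
    simp only [ReadBefore, Prod.mk.injEq]
    omega
  split_ifs with hT
  · have : L.filter (fun r => (¬ ReadBefore r (x, h) ∧ ReadBefore r (x, h + 1)) ∧ r ∉ T) = [] := by
      rw [List.filter_eq_nil_iff]
      intro r _ hr
      simp only [heq, decide_eq_true_eq] at hr
      exact hr.2 (hr.1 ▸ hT)
    rw [this]
    rfl
  · have : L.filter (fun r => (¬ ReadBefore r (x, h) ∧ ReadBefore r (x, h + 1)) ∧ r ∉ T) =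
        [(x, h)] := by
      rw [← hfilter]
      refine List.filter_congr fun r _ => ?_
      simp only [heq, decide_eq_decide]
      exact ⟨fun h => h.1, fun h => ⟨h, h ▸ hT⟩⟩
    rw [this]
    rfl

/-- The label of the pipe that enters the point `(x, h)` from the south. -/
theorem pipeState_south (hL : IsReading n W L) (T : Finset (ℕ × ℕ)) (f : ℕ → ℕ) {x h : ℕ}
    (hh : h < n) (hx : x ≤ W h) : pipeState n L T f (x, h + 1) (x + (n - (h + 1)) + 1) =
      if (x, h) ∈ T then pipeState n L T f (x, h) (x + (n - h))
      else pipeState n L T f (x, h) (x + (n - h) + 1) := by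
  rw [hL.pipeState_up T f hh.le hx, show x + (n - (h + 1)) + 1 = x + (n - h) by omega]
  split_ifs with hT
  · rfl
  · simp only [crossPipes, Function.comp, Equiv.swap_apply_left]

/-- The points read in between lie higher in column `x`, at smaller distance, or lower in column `x
+ 1`, at distance at least `x + (n - h) + 2`. They act away from the two positions of `(x, h)`
except possibly at its lower index or its upper index from outside. -/
theorem pipeState_right (hL : IsReading n W L) (T : Finset (ℕ × ℕ)) (f : ℕ → ℕ) {x h : ℕ}
    (hh : h ≤ n) : ∃ K : List ℕ, (∀ a ∈ K, a ≠ x + (n - h) ∧ a ≠ x + (n - h) + 1) ∧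
      pipeState n L T f (x + 1, h) = K.foldl crossPipes (pipeState n L T f (x, h + 1)) := by
  refine ⟨_, ?_, hL.pipeState_split T f (fun r hr => by simp only [ReadBefore] at *; omega)⟩
  intro a ha
  rw [List.mem_map] at ha
  obtain ⟨⟨r, s⟩, hr, rfl⟩ := ha
  rw [List.mem_filter, decide_eq_true_eq] at hr
  obtain ⟨hr, ⟨h1, h2⟩, h3⟩ := hr
  have := (hL.mem_iff r s).mp hr
  simp only [ReadBefore] at *
  omega

/-- The label of the pipe that enters the point `(x + 1, h)` from the west. -/
theorem pipeState_west (hL : IsReading n W L) (T : Finset (ℕ × ℕ)) (f : ℕ → ℕ) {x h : ℕ}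
    (hh : h ≤ n) (hx : x ≤ W h) : pipeState n L T f (x + 1, h) (x + 1 + (n - h)) =
      if (x, h) ∈ T then pipeState n L T f (x, h) (x + (n - h) + 1)
      else pipeState n L T f (x, h) (x + (n - h)) := by
  obtain ⟨K, hK, he⟩ := hL.pipeState_right T f (x := x) hh
  rw [he, foldl_crossPipes_apply fun a ha => by have := hK a ha; omega, hL.pipeState_up T f hh hx,
    show x + 1 + (n - h) = x + (n - h) + 1 by omega]
  split_ifs with hT
  · rfl
  · simp only [crossPipes, Function.comp, Equiv.swap_apply_right]

/-- The number of labelled pipes above the points of a row. -/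
theorem sum_pipeState_right (hL : IsReading n W L) (T : Finset (ℕ × ℕ)) (f : ℕ → ℕ) {x h : ℕ}
    (hh : h ≤ n) (hx : x ≤ W h) :
    ∑ i ∈ Finset.range (x + 1 + (n - h) + 1), pipeState n L T f (x + 1, h) i =
      ∑ i ∈ Finset.range (x + (n - h) + 1), pipeState n L T f (x, h) i +
        pipeState n L T f (x, h) (x + (n - h) + 1) := by
  obtain ⟨K, hK, he⟩ := hL.pipeState_right T f (x := x) hh
  rw [he, sum_foldl_crossPipes fun a ha => by have := hK a ha; omega, hL.pipeState_up T f hh hx,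
    show x + 1 + (n - h) = x + (n - h) + 1 by omega, ← Finset.sum_range_succ]
  split_ifs with hT
  · rfl
  · exact sum_crossPipes _ (by omega)

theorem pipeState_first (hL : IsReading n W L) (T : Finset (ℕ × ℕ)) (f : ℕ → ℕ) {h : ℕ}
    (hh : h ≤ n) :
    pipeState n L T f (0, h) (n - h) = f (n - h) ∧
      ∑ i ∈ Finset.range (n - h + 1), pipeState n L T f (0, h) i =
        ∑ i ∈ Finset.range (n - h + 1), f i := by
  have key : ∀ a ∈ (L.filter (fun r => ReadBefore r (0, h) ∧ r ∉ T)).map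
      (fun r => r.1 + (n - r.2)), n - h < a := by
    intro a ha
    rw [List.mem_map] at ha
    obtain ⟨⟨r, s⟩, hr, rfl⟩ := ha
    rw [List.mem_filter, decide_eq_true_eq] at hr
    obtain ⟨hr, h1, h3⟩ := hr
    have := (hL.mem_iff r s).mp hr
    simp only [ReadBefore] at *
    omega
  exact ⟨foldl_crossPipes_apply (fun a ha => by have := key a ha; omega) f,
    sum_foldl_crossPipes (fun a ha => by have := key a ha; omega) f⟩

/-- The pipes that enter the shape from below. -/
theorem pipeState_bottom (hL : IsReading n W L) (hW : IsShape n W) {T : Finset (ℕ × ℕ)}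
    (hT : IsFacet n W T) (f : ℕ → ℕ) {x h i : ℕ} (hh : h ≤ n) (hbot : ∀ s < h, W s < x)
    (hi : x + (n - h) < i) : pipeState n L T f (x, h) i = f i := by
  refine foldl_crossPipes_apply (fun a ha => ?_) f
  rw [List.mem_map] at ha
  obtain ⟨⟨r, s⟩, hr, rfl⟩ := ha
  rw [List.mem_filter, decide_eq_true_eq] at hr
  obtain ⟨hr, h1, h3⟩ := hr
  obtain ⟨hs, hrs⟩ := (hL.mem_iff r s).mp hr
  simp only [ReadBefore] at h1
  -- Earlier crossings in lower rows have smaller distance because `W` grows strictly and the row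
  -- ends, being nodes, are not crossings; those in rows at or above `h` lie in earlier columns.
  suffices hlt : r + (n - s) < x + (n - h) by omega
  rcases lt_or_ge s h with hsh | hsh
  · have h4 := hbot (h - 1) (by omega)
    have h5 := hW.add_le (show s ≤ h - 1 by omega) (by omega)
    have h6 : r ≠ W s := fun e => h3 (e ▸ hT.end_mem hW hs)
    omega
  · omega

end IsReading

/-- The labels of the pipes that enter the rows up to the row at height `J` and leave them in north
direction, without the one that enters this row from the west. -/
def rowLabel (n : ℕ) (W : ℕ → ℕ) (J : ℕ) : ℕ → ℕ :=
  fun i => if n - J < i ∧ i ≤ W J + (n - J) then 1 else 0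

namespace IsReading

variable {n : ℕ} {W : ℕ → ℕ} {L : List (ℕ × ℕ)} {T : Finset (ℕ × ℕ)}

/-- Each step east in a row adds, to the pipes above, just the one that entered the previous point
from the south. -/
theorem sum_pipeState_eq (hL : IsReading n W L) (T : Finset (ℕ × ℕ)) (f : ℕ → ℕ) {x h : ℕ}
    (hh : h ≤ n) (hx : x ≤ W h) :
    ∑ i ∈ Finset.range (x + (n - h) + 1), pipeState n L T f (x, h) i =
      ∑ i ∈ Finset.range (n - h + 1), f i +
        ∑ z ∈ Finset.range x, pipeState n L T f (z, h) (z + (n - h) + 1) := by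
  induction x with
  | zero => simpa using (hL.pipeState_first T f hh).2
  | succ x ih =>
    rw [hL.sum_pipeState_right T f hh (by omega), ih (by omega), add_assoc,
      Finset.sum_range_succ (fun z => pipeState n L T f (z, h) (z + (n - h) + 1))]

theorem west_eq_one (hL : IsReading n W L) (hW : IsShape n W) {J h : ℕ} (hJ : J ≤ n) (hh : h < J)
    (hS : ∀ x < W h, pipeState n L T (rowLabel n W J) (x, h) (x + (n - h) + 1) = 1) {x : ℕ}
    (hx : x ≤ W h) : pipeState n L T (rowLabel n W J) (x, h) (x + (n - h)) = 1 := by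
  induction x with
  | zero =>
    rw [zero_add, (hL.pipeState_first T _ (by omega)).1, rowLabel, if_pos]
    have := hW.add_le (Nat.zero_le J) hJ
    omega
  | succ x ih =>
    rw [hL.pipeState_west T _ (by omega) (by omega)]
    split_ifs
    · exact hS x (by omega)
    · exact ih (by omega)

/-- The pipes that have entered so far, from below or from the west in rows under `J`, all carry
label 1, so no contact or crossing can produce anything else. -/
theorem south_eq_one (hL : IsReading n W L) (hW : IsShape n W) (hT : IsFacet n W T) {J h : ℕ}
    (hJ : J ≤ n) (hh : h ≤ J) {x : ℕ} (hx : x < W h) :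
    pipeState n L T (rowLabel n W J) (x, h) (x + (n - h) + 1) = 1 := by
  induction h generalizing x with
  | zero => rw [hW.zero] at hx; omega
  | succ h ih =>
    rcases le_or_gt x (W h) with hxh | hxh
    · rw [hL.pipeState_south T _ (by omega) hxh]
      split_ifs with hn
      · exact hL.west_eq_one hW hJ hh (fun x hx => ih (by omega) hx) hxh
      · have hne : x ≠ W h := fun e => hn (e ▸ hT.end_mem hW (by omega))
        exact ih (by omega) (by omega)
    · rw [hL.pipeState_bottom hW hT _ (by omega) _ (by omega), rowLabel, if_pos]
      · have := hW.add_le hh hJ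
        omega
      · intro s hs
        have := hW.le (show s ≤ h by omega) (by omega)
        omega

/-- One row of pipes, above the row at height `J`. -/
theorem south_step (hL : IsReading n W L) (hW : IsShape n W) (hT : IsFacet n W T) {J h c : ℕ}
    (hJh : J ≤ h) (hh : h < n) (hc : c ≤ W J)
    (hS : ∀ x ≤ W h, pipeState n L T (rowLabel n W J) (x, h) (x + (n - h) + 1) =
      if x ≤ W J ∧ x ≠ c then 1 else 0)
    (hkey : leftmost T h ≤ W J → (c, h) ∈ T ∧ ∀ x, (x, h) ∈ T → x ≤ W J → x ≤ c) (x : ℕ) :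
    pipeState n L T (rowLabel n W J) (x, h + 1) (x + (n - (h + 1)) + 1) =
      if x ≤ W J ∧ x ≠ (if leftmost T h ≤ W J then leftmost T h else c) then 1 else 0 := by
  have hWJ := hW.le hJh hh.le
  -- The unlabelled pipe from the west turns north at the leftmost node if that is in reach, which
  -- sends a labelled pipe east until it fills the gap in column `c`. If the leftmost node is beyond
  -- `W J`, no labelled pipe travels east.
  have hwest : ∀ x ≤ W h, pipeState n L T (rowLabel n W J) (x, h) (x + (n - h)) =
      if leftmost T h ≤ W J ∧ leftmost T h < x ∧ x ≤ c then 1 else 0 := by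
    intro x hx
    induction x with
    | zero =>
      rw [zero_add, (hL.pipeState_first T _ hh.le).1, rowLabel, if_neg (by omega),
        if_neg (by omega)]
    | succ x ih =>
      rw [hL.pipeState_west T _ hh.le (by omega), ih (by omega), hS x (by omega)]
      by_cases hl : leftmost T h ≤ W J
      · obtain ⟨hcT, hright⟩ := hkey hl
        have hlc := leftmost_le hcT
        by_cases hxT : (x, h) ∈ T
        · have h1 := leftmost_le hxT
          have h2 := hright x hxT
          simp only [hxT, if_true]
          congr 1
          simp only [eq_iff_iff]
          omega
        · have h1 : x ≠ c := fun e => hxT (e ▸ hcT)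
          have h2 : x ≠ leftmost T h := fun e => hxT (e ▸ hT.leftmost_mem hW hh.le)
          simp only [hxT, if_false]
          congr 1
          simp only [eq_iff_iff]
          omega
      · by_cases hxT : (x, h) ∈ T
        · have h1 := leftmost_le hxT
          simp only [hxT, if_true]
          rw [if_neg (by omega), if_neg (by omega)]
        · simp only [hxT, if_false]
          rw [if_neg (by omega), if_neg (by omega)]
  rcases le_or_gt x (W h) with hxh | hxh
  · rw [hL.pipeState_south T _ hh hxh, hwest x hxh, hS x hxh]
    by_cases hl : leftmost T h ≤ W J
    · obtain ⟨hcT, hright⟩ := hkey hl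
      have hlc := leftmost_le hcT
      by_cases hxT : (x, h) ∈ T
      · have h1 := leftmost_le hxT
        have h2 := hright x hxT
        simp only [hxT, hl, if_true]
        congr 1
        simp only [eq_iff_iff, true_and]
        omega
      · have h1 : x ≠ c := fun e => hxT (e ▸ hcT)
        have h2 : x ≠ leftmost T h := fun e => hxT (e ▸ hT.leftmost_mem hW hh.le)
        simp only [hxT, hl, if_false, if_true]
        congr 1
        simp only [eq_iff_iff]
        omega
    · simp only [hl, if_false]
      by_cases hxT : (x, h) ∈ T
      · have h1 := leftmost_le hxT
        simp only [hxT, if_true]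
        rw [if_neg (by omega), if_neg (by omega)]
      · simp only [hxT, if_false]
  · rw [hL.pipeState_bottom hW hT _ (by omega) _ (by omega), rowLabel, if_neg, if_neg]
    · omega
    · have := hW.add_le hJh hh.le
      omega
    · intro s hs
      have := hW.le (show s ≤ h by omega) (by omega)
      omega

/-- The gap starts at the row end `W J` when row `J` is entered, and `south_step` moves it by the
recursion `pathColumn_succ`. -/
theorem south_eq (hL : IsReading n W L) (hW : IsShape n W) (hT : IsFacet n W T) {J b : ℕ}
    (hJb : J ≤ b) (hb : b < n) (x : ℕ) :
    pipeState n L T (rowLabel n W J) (x, b + 1) (x + (n - (b + 1)) + 1) =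
      if x ≤ W J ∧ x ≠ pathColumn T W J b then 1 else 0 := by
  induction b, hJb using Nat.le_induction generalizing x with
  | base =>
    have hl := hT.leftmost_le_width hW hb.le
    rw [hL.south_step hW hT le_rfl hb (c := W J) le_rfl _ _ x, if_pos hl,
      hT.pathColumn_self hW hb.le]
    · intro x hx
      rcases hx.eq_or_lt with rfl | hx
      · rw [if_neg (by omega), hL.pipeState_bottom hW hT _ hb.le _ (by omega), rowLabel,
          if_neg (by omega)]
        exact fun s hs => hW.lt hs hb.le
      · rw [if_pos (by omega), hL.south_eq_one hW hT hb.le le_rfl hx]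
    · exact fun _ => ⟨hT.end_mem hW hb.le, fun x _ hx => hx⟩
  | succ b hJb ih =>
    rw [hL.south_step hW hT (by omega) hb (hT.pathColumn_le hW hJb (by omega))
      (fun x _ => ih (by omega) x) (fun hl => hT.pathColumn_mem hW hJb (by omega) hl) x,
      pathColumn_succ]

/-- The number of labelled pipes above the points of the shape, for the labels that belong to the
row at height `J`. -/
theorem exists_sum_pipeState (hL : IsReading n W L) (hW : IsShape n W) {J : ℕ}
    (hJn : J ≤ n) : ∃ A B : ℕ, ∀ T, IsFacet n W T →
      ∑ h ∈ Finset.range (n + 1), ∑ x ∈ Finset.range (W h + 1),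
        ∑ i ∈ Finset.range (x + (n - h) + 1), pipeState n L T (rowLabel n W J) (x, h) i + B =
      A + pathArea n W T J := by
  -- `A` is the count as if no column were missing. In a row `h` above `J` the gap in column `c`
  -- lowers the count by one at each of the `W h - c` points to its right; `B` collects the `W h`,
  -- and the columns `c` add up to the area.
  refine ⟨∑ h ∈ Finset.range (n + 1), ∑ x ∈ Finset.range (W h + 1),
    (∑ i ∈ Finset.range (n - h + 1), rowLabel n W J i + min x (W J + 1)),
    ∑ h ∈ Finset.Ico (J + 1) (n + 1), W h, fun T hT => ?_⟩
  have hlow : ∀ h ∈ Finset.Ico 0 (J + 1), ∑ x ∈ Finset.range (W h + 1),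
      ∑ i ∈ Finset.range (x + (n - h) + 1), pipeState n L T (rowLabel n W J) (x, h) i =
      ∑ x ∈ Finset.range (W h + 1),
        (∑ i ∈ Finset.range (n - h + 1), rowLabel n W J i + min x (W J + 1)) := by
    intro h hh
    rw [Finset.mem_Ico] at hh
    refine Finset.sum_congr rfl fun x hx => ?_
    rw [Finset.mem_range] at hx
    rw [hL.sum_pipeState_eq T _ (by omega) (by omega), Finset.sum_congr rfl fun z hz =>
      hL.south_eq_one hW hT hJn (by omega) (by rw [Finset.mem_range] at hz; omega)]
    have := hW.le (show h ≤ J by omega) hJn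
    rw [min_eq_left (by omega)]
    simp
  have hhigh : ∀ h ∈ Finset.Ico (J + 1) (n + 1), ∑ x ∈ Finset.range (W h + 1),
      ∑ i ∈ Finset.range (x + (n - h) + 1), pipeState n L T (rowLabel n W J) (x, h) i + W h =
      ∑ x ∈ Finset.range (W h + 1),
        (∑ i ∈ Finset.range (n - h + 1), rowLabel n W J i + min x (W J + 1)) +
        pathColumn T W J (h - 1) := by
    intro h hh
    rw [Finset.mem_Ico] at hh
    obtain ⟨b, rfl⟩ : ∃ b, h = b + 1 := ⟨h - 1, by omega⟩
    set c := pathColumn T W J b with hc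
    have hcJ : c ≤ W J := hT.pathColumn_le hW (by omega) (by omega)
    have hJb := hW.le (show J ≤ b + 1 by omega) (by omega)
    have hcount : ∀ x, (∑ z ∈ Finset.range x, if z ≤ W J ∧ z ≠ c then 1 else 0) +
        (if c < x then 1 else 0) = min x (W J + 1) := by
      intro x
      induction x with
      | zero => simp
      | succ x ih =>
        rw [Finset.sum_range_succ]
        split_ifs at * <;> omega
    have hsum : ∀ m, c ≤ m → ∑ x ∈ Finset.range (m + 1), (if c < x then 1 else 0) + c = m := by
      intro m hm
      induction m, hm using Nat.le_induction with
      | base =>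
        rw [Finset.sum_eq_zero, zero_add]
        intro x hx
        rw [Finset.mem_range] at hx
        exact if_neg (by omega)
      | succ m hm ih =>
        rw [Finset.sum_range_succ, if_pos (by omega)]
        omega
    have hm := hsum (W (b + 1)) (by omega)
    have hrow : ∑ x ∈ Finset.range (W (b + 1) + 1), ∑ i ∈ Finset.range (x + (n - (b + 1)) + 1),
        pipeState n L T (rowLabel n W J) (x, b + 1) i +
        ∑ x ∈ Finset.range (W (b + 1) + 1), (if c < x then 1 else 0) =
        ∑ x ∈ Finset.range (W (b + 1) + 1),
        (∑ i ∈ Finset.range (n - (b + 1) + 1), rowLabel n W J i + min x (W J + 1)) := by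
      rw [← Finset.sum_add_distrib]
      refine Finset.sum_congr rfl fun x hx => ?_
      rw [Finset.mem_range] at hx
      rw [hL.sum_pipeState_eq T _ (by omega) (by omega), ← hcount x, ← add_assoc,
        Finset.sum_congr rfl fun z hz => hL.south_eq hW hT (by omega) (by omega) z]
    rw [Nat.add_sub_cancel]
    omega
  rw [Finset.range_eq_Ico (n + 1), ← Finset.sum_Ico_consecutive _ (Nat.zero_le _)
    (show J + 1 ≤ n + 1 by omega), ← Finset.sum_Ico_consecutive _ (Nat.zero_le _)
    (show J + 1 ≤ n + 1 by omega), Finset.sum_congr rfl hlow, add_assoc, add_assoc,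
    ← Finset.sum_add_distrib, Finset.sum_congr rfl hhigh, Finset.sum_add_distrib, pathArea,
    ← Finset.sum_Ico_add' (fun h => pathColumn T W J (h - 1)) J n 1]
  simp only [Nat.add_sub_cancel]

/-- Labels that are respected by all crossings. -/
theorem pipeState_eq_self (hL : IsReading n W L) (hW : IsShape n W) (hT : IsFacet n W T)
    (p : ℕ × ℕ) :
    pipeState n L T (fun i => if 1 ≤ i ∧ i ≤ W n then 1 else 0) p =
      fun i => if 1 ≤ i ∧ i ≤ W n then 1 else 0 := by
  refine foldl_crossPipes_eq fun a ha => ?_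
  rw [List.mem_map] at ha
  obtain ⟨⟨r, s⟩, hr, rfl⟩ := ha
  rw [List.mem_filter, decide_eq_true_eq] at hr
  obtain ⟨hr, h1, h3⟩ := hr
  obtain ⟨hs, hrs⟩ := (hL.mem_iff r s).mp hr
  -- The labels change only between positions 0 and 1 and between `W n` and `W n + 1`. Distance 0
  -- occurs only at the root and distance `W n` only at row ends, all of which are nodes.
  have h4 : r ≠ W s := fun e => h3 (e ▸ hT.end_mem hW hs)
  have h5 : (r, s) ≠ (0, n) := fun e => h3 (e ▸ hT.root_mem)
  have h6 := hW.add_le hs le_rfl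
  simp only [ne_eq, Prod.mk.injEq, not_and] at h5
  congr 1
  simp only [eq_iff_iff]
  omega

end IsReading

/-! ### Brick vectors and pipes -/

theorem apply_prod_simpleTransposition {m r : ℕ} (Q : Fin m → Fin r) (K : List (Fin m)) (f : ℕ → ℕ)
    (a : Fin (r + 1)) :
    f ((K.map (fun j => simpleTransposition (Q j))).prod a) =
      (K.map (fun j => (Q j : ℕ))).foldl crossPipes f a := by
  induction K generalizing f with
  | nil => rfl
  | cons j K ih =>
    rw [List.map_cons, List.prod_cons, List.map_cons, List.foldl_cons, ← ih, Equiv.Perm.mul_apply]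
    generalize (K.map (fun j => simpleTransposition (Q j))).prod a = b
    simp only [crossPipes, Function.comp]
    congr 1
    unfold simpleTransposition
    simp only [Equiv.swap_apply_def, Fin.ext_iff, Fin.val_castSucc, Fin.val_succ]
    split_ifs <;> simp

theorem apply_subwordProd {n r : ℕ} {L : List (ℕ × ℕ)} (hL : L.Pairwise ReadBefore)
    (T : Finset (ℕ × ℕ)) (Q : Fin L.length → Fin r)
    (hQ : ∀ j, (Q j : ℕ) = (L.get j).1 + (n - (L.get j).2)) (f : ℕ → ℕ) (j : Fin L.length)
    (a : Fin (r + 1)) :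
    f (subwordProd Q (Finset.univ.filter (fun i => i < j ∧
      i ∉ Finset.univ.filter (fun i => L.get i ∈ T))) a) = pipeState n L T f (L.get j) a := by
  unfold subwordProd
  rw [apply_prod_simpleTransposition Q _ f]
  unfold pipeState
  have hlt : ∀ i : Fin L.length, i < j ↔ ReadBefore (L.get i) (L.get j) := by
    intro i
    constructor
    · exact fun h => List.pairwise_iff_get.mp hL _ _ h
    · intro h
      by_contra hle
      rcases (not_lt.mp hle).eq_or_lt with rfl | hlt
      · simp only [ReadBefore] at h
        omega
      · have := List.pairwise_iff_get.mp hL _ _ hlt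
        simp only [ReadBefore] at h this
        omega
  have hfilter : L.filter (fun r => ReadBefore r (L.get j) ∧ r ∉ T) =
      ((List.finRange L.length).filter (fun i => ReadBefore (L.get i) (L.get j) ∧ L.get i ∉ T)).map
        L.get := by
    have := List.filter_map (f := L.get) (p := fun r => ReadBefore r (L.get j) ∧ r ∉ T)
      (l := List.finRange L.length)
    rw [List.map_get_finRange] at this
    exact this
  rw [hfilter, List.map_map]
  have hQ' : (fun i => (Q i : ℕ)) = (fun r : ℕ × ℕ => r.1 + (n - r.2)) ∘ L.get := funext hQ
  rw [hQ']
  refine congrArg (fun K : List (Fin L.length) => (K.map ((fun r : ℕ × ℕ => r.1 + (n - r.2)) ∘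
    L.get)).foldl crossPipes f a) (List.filter_congr fun i _ => ?_)
  simp only [Finset.mem_filter, Finset.mem_univ, true_and, hlt]

/-- Reindexing the coordinates by the prefix permutation moves it from the fundamental weight onto
`f`, where it becomes the sequence of crossings; the weight then sums the first `d(p) + 1`
positions. -/
theorem sum_mul_brickVector {n r : ℕ} {L : List (ℕ × ℕ)} (hL : L.Pairwise ReadBefore)
    (T : Finset (ℕ × ℕ)) (Q : Fin L.length → Fin r)
    (hQ : ∀ j, (Q j : ℕ) = (L.get j).1 + (n - (L.get j).2)) (f : ℕ → ℕ) :
    ∑ l : Fin (r + 1), (f l : ℝ) * brickVector Q (Finset.univ.filter (fun j => L.get j ∈ T)) l =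
      - (((L.map (fun p => ∑ i ∈ Finset.range (p.1 + (n - p.2) + 1), pipeState n L T f p i)).sum :
        ℕ) : ℝ) := by
  unfold brickVector
  simp only [Pi.neg_apply, Finset.sum_apply, mul_neg, Finset.sum_neg_distrib, Finset.mul_sum]
  rw [Finset.sum_comm, ← Fin.sum_univ_fun_getElem, Nat.cast_sum]
  congr 1
  refine Finset.sum_congr rfl fun j _ => ?_
  unfold weightFunction permAct
  rw [← Equiv.sum_comp (subwordProd Q (Finset.univ.filter (fun i => i < j ∧
      i ∉ Finset.univ.filter (fun i => L.get i ∈ T))))]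
  simp only [Equiv.Perm.coe_inv, Equiv.symm_apply_apply]
  simp only [apply_subwordProd hL T Q hQ]
  unfold fundamentalWeight
  have hj := hQ j
  simp only [List.get_eq_getElem] at hj ⊢
  simp only [Fin.le_def, Fin.val_castSucc]
  rw [← hj, Nat.cast_sum, Fin.sum_univ_eq_sum_range (fun i => ((pipeState n L T f L[(j : ℕ)] i : ℕ) : ℝ) *
    (if i ≤ Q j then 1 else 0)) (r + 1)]
  have hsub : Finset.range ((Q j : ℕ) + 1) ⊆ Finset.range (r + 1) := by
    have := (Q j).isLt
    exact Finset.range_subset_range.mpr (by omega)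
  rw [← Finset.sum_subset hsub]
  · refine Finset.sum_congr rfl fun i hi => ?_
    rw [Finset.mem_range] at hi
    rw [if_pos (by omega), mul_one]
  · intro i _ hi
    rw [Finset.mem_range] at hi
    rw [if_neg (by omega), mul_zero]

theorem IsReading.sum_map {n : ℕ} {W : ℕ → ℕ} {L : List (ℕ × ℕ)} (hL : IsReading n W L)
    (F : ℕ × ℕ → ℕ) : (L.map F).sum =
      ∑ h ∈ Finset.range (n + 1), ∑ x ∈ Finset.range (W h + 1), F (x, h) := by
  have hnodup : L.Nodup := hL.sorted.imp fun {a b} hab he => by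
    subst he
    simp only [ReadBefore] at hab
    omega
  rw [← List.sum_toFinset _ hnodup]
  refine Finset.sum_finset_product_right' L.toFinset (Finset.range (n + 1))
    (fun h => Finset.range (W h + 1)) (f := fun x h => F (x, h)) fun p => ?_
  rw [List.mem_toFinset, hL.mem_iff, Finset.mem_range, Finset.mem_range]
  omega

/-! ### The shape of the path `(N E^{k_n}) ⋯ (N E^{k_1})` -/

/-- The row widths of the Ferrers diagram above the path `(N E^{k_n}) ⋯ (N E^{k_1})`. -/
def rowWidth (n : ℕ) (k : ℕ → ℕ) (h : ℕ) : ℕ := ∑ j ∈ Finset.range h, k (n - j)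

theorem isShape_rowWidth {n : ℕ} {k : ℕ → ℕ} (hk : ∀ i ∈ Finset.Icc 1 n, 1 ≤ k i) :
    IsShape n (rowWidth n k) := by
  refine ⟨by simp [rowWidth], fun h hh => ?_⟩
  have := hk (n - h) (Finset.mem_Icc.mpr (by omega))
  rw [rowWidth, rowWidth, Finset.sum_range_succ]
  omega

theorem pathHeight_flatMap (k : ℕ → ℕ) (M : List ℕ) :
    pathHeight (M.flatMap (fun j => PathStep.N :: List.replicate (k j) PathStep.E)) =
      M.length := by
  induction M with
  | nil => rfl
  | cons a M ih =>
    rw [List.flatMap_cons]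
    simp only [pathHeight, List.count_append] at *
    rw [ih]
    simp [List.count_replicate, add_comm]

theorem pathWidth_flatMap (k : ℕ → ℕ) (M : List ℕ) :
    pathWidth (M.flatMap (fun j => PathStep.N :: List.replicate (k j) PathStep.E)) =
      (M.map k).sum := by
  induction M with
  | nil => rfl
  | cons a M ih =>
    rw [List.flatMap_cons]
    simp only [pathWidth, List.count_append] at *
    rw [ih]
    simp

theorem pathWidth_le_of_prefix (k : ℕ → ℕ) (M : List ℕ) : ∀ l,
    l <+: M.flatMap (fun j => PathStep.N :: List.replicate (k j) PathStep.E) →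
      pathWidth l ≤ ((M.take (pathHeight l)).map k).sum := by
  induction M with
  | nil =>
    intro l hl
    simp at hl
    simp [hl, pathWidth]
  | cons a M ih =>
    intro l hl
    rw [List.flatMap_cons] at hl
    rcases List.prefix_or_prefix_of_prefix hl (List.prefix_append _ _) with h | h
    · rcases List.prefix_cons_iff.mp h with rfl | ⟨t, rfl, ht⟩
      · simp [pathWidth]
      · have h1 := ht.sublist.count_le PathStep.E
        have h2 := ht.sublist.count_le PathStep.N
        simp [List.count_replicate] at h1 h2
        simp [pathWidth, pathHeight, h1, h2]
    · obtain ⟨t, rfl⟩ := h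
      have := ih t ((List.prefix_append_right_inj _).mp hl)
      simp only [pathWidth, pathHeight, List.count_append] at *
      simp only [List.count_cons, List.count_replicate] at *
      simp only [beq_self_eq_true, if_true, beq_iff_eq, reduceCtorEq, if_false, zero_add]
      rw [add_comm 1, List.take_succ_cons, List.map_cons, List.sum_cons]
      omega

theorem nePath_eq (n : ℕ) (k : ℕ → ℕ) : nePath n k = ((List.range n).map (fun j => n - j)).flatMap
    (fun j => PathStep.N :: List.replicate (k j) PathStep.E) := by
  rw [List.flatMap_map]
  rfl

theorem sum_take_map_range (n : ℕ) (k : ℕ → ℕ) {h : ℕ} (hh : h ≤ n) :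
    ((((List.range n).map (fun j => n - j)).take h).map k).sum = rowWidth n k h := by
  rw [← List.map_take, List.take_range, min_eq_left hh, List.map_map]
  rfl

theorem pathHeight_nePath (n : ℕ) (k : ℕ → ℕ) : pathHeight (nePath n k) = n := by
  rw [nePath_eq, pathHeight_flatMap]
  simp

theorem pathWidth_nePath (n : ℕ) (k : ℕ → ℕ) : pathWidth (nePath n k) = rowWidth n k n := by
  rw [nePath_eq, pathWidth_flatMap, ← sum_take_map_range n k le_rfl, List.take_of_length_le]
  simp

theorem mem_latticePointsAbove_nePath {n : ℕ} {k : ℕ → ℕ}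
    (hk : ∀ i ∈ Finset.Icc 1 n, 1 ≤ k i) {a b : ℕ} :
    (a, b) ∈ latticePointsAbove (nePath n k) ↔ b ≤ n ∧ a ≤ rowWidth n k b := by
  rw [latticePointsAbove, Finset.mem_filter, Finset.mem_product, Finset.mem_range,
    Finset.mem_range, pathHeight_nePath, pathWidth_nePath]
  simp only [List.mem_inits]
  constructor
  · rintro ⟨⟨-, h1⟩, l, hl, h2, h3⟩
    refine ⟨by omega, h3.trans ?_⟩
    rw [nePath_eq] at hl
    have := pathWidth_le_of_prefix k _ l hl
    rwa [h2, sum_take_map_range n k (by omega)] at this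
  · rintro ⟨h1, h2⟩
    have := (isShape_rowWidth hk).le h1 le_rfl
    refine ⟨⟨by omega, by omega⟩, (((List.range n).map (fun j => n - j)).take b).flatMap
      (fun j => PathStep.N :: List.replicate (k j) PathStep.E), ?_, ?_, ?_⟩
    · rw [nePath_eq]
      conv_rhs => rw [← List.take_append_drop b ((List.range n).map (fun j => n - j))]
      rw [List.flatMap_append]
      exact List.prefix_append _ _
    · rw [pathHeight_flatMap]
      simpa using h1
    · rwa [pathWidth_flatMap, sum_take_map_range n k h1]

theorem isReading_readingOrder {n : ℕ} {k : ℕ → ℕ} (hk : ∀ i ∈ Finset.Icc 1 n, 1 ≤ k i) :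
    IsReading n (rowWidth n k) (readingOrder (nePath n k)) := by
  constructor
  · unfold readingOrder
    rw [List.pairwise_flatMap]
    constructor
    · intro x _
      refine List.Pairwise.filter _ ?_
      rw [List.pairwise_map]
      exact List.pairwise_lt_range.imp fun h => Or.inr ⟨rfl, h⟩
    · refine List.pairwise_lt_range.imp fun {x y} hxy => ?_
      intro p hp q hq
      simp only [List.mem_filter, List.mem_map] at hp hq
      obtain ⟨⟨_, -, rfl⟩, -⟩ := hp
      obtain ⟨⟨_, -, rfl⟩, -⟩ := hq
      exact Or.inl hxy
  · intro a b
    rw [← mem_latticePointsAbove_nePath hk]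
    constructor
    · exact mem_latticePointsAbove_of_mem_readingOrder
    · intro h
      have h' := h
      rw [latticePointsAbove, Finset.mem_filter, Finset.mem_product, Finset.mem_range,
        Finset.mem_range] at h'
      unfold readingOrder
      rw [List.mem_flatMap]
      refine ⟨a, List.mem_range.mpr h'.1.1, ?_⟩
      rw [List.mem_filter]
      exact ⟨List.mem_map.mpr ⟨b, List.mem_range.mpr h'.1.2, rfl⟩, by simpa using h⟩

theorem nuIncompatible_nePath_iff {n : ℕ} {k : ℕ → ℕ} (hk : ∀ i ∈ Finset.Icc 1 n, 1 ≤ k i)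
    {a b c d : ℕ} (hac : a < c) (hbd : b < d) (hd : d ≤ n) :
    NuIncompatible (nePath n k) (a, b) (c, d) ↔ c ≤ rowWidth n k b := by
  unfold NuIncompatible
  have h1 : (a, b) ⊓ (c, d) = (a, b) := inf_eq_left.mpr ⟨hac.le, hbd.le⟩
  have h2 : (a, b) ⊔ (c, d) = (c, d) := sup_eq_right.mpr ⟨hac.le, hbd.le⟩
  rw [h1, h2]
  constructor
  · rintro ⟨-, h⟩
    have : (c, b) ∈ Finset.Icc (a, b) (c, d) := Finset.mem_Icc.mpr ⟨⟨hac.le, le_rfl⟩, ⟨le_rfl, hbd.le⟩⟩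
    exact ((mem_latticePointsAbove_nePath hk).mp (h this)).2
  · intro h
    refine ⟨Or.inl ⟨hac, hbd⟩, ?_⟩
    rintro ⟨x, y⟩ hxy
    obtain ⟨⟨h3, h4⟩, ⟨h5, h6⟩⟩ := Finset.mem_Icc.mp hxy
    simp only at h3 h4 h5 h6
    refine (mem_latticePointsAbove_nePath hk).mpr ⟨by omega, ?_⟩
    exact (h5.trans h).trans ((isShape_rowWidth hk).le h4 (by omega))

theorem nuIncompatible_comm {ν : List PathStep} {p q : ℕ × ℕ} (h : NuIncompatible ν p q) :
    NuIncompatible ν q p := by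
  unfold NuIncompatible at *
  rw [inf_comm, sup_comm]
  exact ⟨h.1.symm, h.2⟩

theorem isTamariFace_nePath_iff {n : ℕ} {k : ℕ → ℕ} (hk : ∀ i ∈ Finset.Icc 1 n, 1 ≤ k i)
    {I : Finset (ℕ × ℕ)} : IsTamariFace (nePath n k) I ↔ IsFace n (rowWidth n k) I := by
  constructor
  · rintro ⟨h1, h2⟩
    have h3 : ∀ a b, (a, b) ∈ I → b ≤ n ∧ a ≤ rowWidth n k b := fun a b hab =>
      (mem_latticePointsAbove_nePath hk).mp (h1 hab)
    refine ⟨h3, fun a b c d hab hcd hac hbd => ?_⟩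
    have := h2 _ hab _ hcd
    rw [nuIncompatible_nePath_iff hk hac hbd (h3 c d hcd).1] at this
    omega
  · rintro ⟨h1, h2⟩
    refine ⟨fun p hp => (mem_latticePointsAbove_nePath hk).mpr (h1 _ _ hp), ?_⟩
    have key : ∀ a b c d, (a, b) ∈ I → (c, d) ∈ I → a < c → b < d →
        ¬ NuIncompatible (nePath n k) (a, b) (c, d) := by
      intro a b c d hab hcd hac hbd
      rw [nuIncompatible_nePath_iff hk hac hbd (h1 c d hcd).1]
      have := h2 a b c d hab hcd hac hbd
      omega
    rintro ⟨a, b⟩ hab ⟨c, d⟩ hcd h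
    rcases h.1 with ⟨h3, h4⟩ | ⟨h3, h4⟩
    · exact key a b c d hab hcd h3 h4 h
    · exact key c d a b hcd hab h3 h4 (nuIncompatible_comm h)

theorem isNuTree_nePath_iff {n : ℕ} {k : ℕ → ℕ} (hk : ∀ i ∈ Finset.Icc 1 n, 1 ≤ k i)
    {T : Finset (ℕ × ℕ)} : IsNuTree (nePath n k) T ↔ IsFacet n (rowWidth n k) T := by
  rw [isFacet_iff_maximal, IsNuTree,
    show IsTamariFace (nePath n k) = IsFace n (rowWidth n k) from
      funext fun I => propext (isTamariFace_nePath_iff hk)]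

/-! ### The projected brick vectors -/

theorem maxDist_nePath_eq {n : ℕ} {k : ℕ → ℕ} (hk : ∀ i ∈ Finset.Icc 1 n, 1 ≤ k i) :
    maxDist (nePath n k) = rowWidth n k n := by
  apply le_antisymm
  · refine Finset.sup_le fun p hp => ?_
    obtain ⟨a, b⟩ := p
    obtain ⟨h1, h2⟩ := (mem_latticePointsAbove_nePath hk).mp hp
    have := (isShape_rowWidth hk).add_le h1 le_rfl
    simp only [distTopLeft, pathHeight_nePath]
    omega
  · have h : (rowWidth n k n, n) ∈ latticePointsAbove (nePath n k) :=
      (mem_latticePointsAbove_nePath hk).mpr ⟨le_rfl, le_rfl⟩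
    have := Finset.le_sup (f := distTopLeft (nePath n k)) h
    simp only [distTopLeft, pathHeight_nePath] at this
    unfold maxDist
    omega

theorem lastElements_Icc (c m : ℕ) : lastElements c (Finset.Icc 1 m) = Finset.Ioc (m - c) m := by
  ext x
  rw [lastElements, Finset.mem_filter, Finset.mem_Icc, Finset.mem_Ioc]
  have h : (Finset.Icc 1 m).filter (fun z => x < z) = Finset.Ioc x m := by
    ext z
    simp only [Finset.mem_filter, Finset.mem_Icc, Finset.mem_Ioc]
    omega
  rw [h, Nat.card_Ioc]
  omega

theorem rowWidth_sub {n j : ℕ} (k : ℕ → ℕ) (hj : j < n) :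
    rowWidth n k (n - j) = rowWidth n k (n - (j + 1)) + k (j + 1) := by
  obtain ⟨h, hh⟩ : ∃ h, n - j = h + 1 := ⟨n - j - 1, by omega⟩
  rw [hh, show n - (j + 1) = h by omega, rowWidth, rowWidth, Finset.sum_range_succ,
    show n - h = j + 1 by omega]

theorem remainingIndices_eq {n : ℕ} {k : ℕ → ℕ} (hk : ∀ i ∈ Finset.Icc 1 n, 1 ≤ k i) {j : ℕ}
    (hj : j ≤ n) :
    remainingIndices k (rowWidth n k n) j = Finset.Icc 1 (rowWidth n k (n - j) + j) := by
  induction j with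
  | zero => rfl
  | succ j ih =>
    rw [remainingIndices, ih (by omega), lastElements_Icc]
    have h1 := rowWidth_sub k hj
    have h2 := hk (j + 1) (Finset.mem_Icc.mpr (by omega))
    ext x
    simp only [Finset.mem_sdiff, Finset.mem_Icc, Finset.mem_Ioc]
    omega

theorem mem_setM_iff {n : ℕ} {k : ℕ → ℕ} (hk : ∀ i ∈ Finset.Icc 1 n, 1 ≤ k i) {j a : ℕ}
    (hj : j < n) : a ∈ setM k (rowWidth n k n) (j + 1) ↔
      (rowWidth n k (n - (j + 1)) + (j + 1) < a ∧ a ≤ rowWidth n k (n - j) + j) ∨ a = j + 1 := by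
  rw [setM, tildeM, Nat.add_sub_cancel, remainingIndices_eq hk hj.le, lastElements_Icc]
  have h1 := rowWidth_sub k hj
  have h2 := hk (j + 1) (Finset.mem_Icc.mpr (by omega))
  simp only [Finset.mem_union, Finset.mem_Ioc, Finset.mem_singleton]
  omega

/-- Each `M_j` is `{j}` together with an interval at the upper end of what remains, so `M_1 ∪ ⋯ ∪
M_m` consists of `1, …, m` and a final segment. Its complement is the interval labelled by
`rowLabel` for `J = n - m`. -/
theorem proj_apply {n : ℕ} {k : ℕ → ℕ} (hk : ∀ i ∈ Finset.Icc 1 n, 1 ≤ k i) {N : ℕ}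
    (hN : N = rowWidth n k n) (x : Fin N → ℝ) (i : Fin (n - 1)) :
    proj n k x i = ∑ a : Fin N, if (a : ℕ) + 1 ≤ i + 1 ∨
      rowWidth n k (n - (i + 1)) + (i + 1) < (a : ℕ) + 1 then x a else 0 := by
  subst hN
  have key : ∀ m ≤ n, ∑ j ∈ Finset.range m, ∑ a ∈ Finset.univ.filter
      (fun a : Fin (rowWidth n k n) => (a : ℕ) + 1 ∈ setM k (rowWidth n k n) (j + 1)), x a =
      ∑ a ∈ Finset.univ.filter (fun a : Fin (rowWidth n k n) => (a : ℕ) + 1 ≤ m ∨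
        rowWidth n k (n - m) + m < (a : ℕ) + 1), x a := by
    intro m hm
    induction m with
    | zero =>
      rw [Finset.sum_range_zero, Finset.filter_false_of_mem, Finset.sum_empty]
      intro a _
      have := a.isLt
      rw [Nat.sub_zero]
      omega
    | succ m ih =>
      rw [Finset.sum_range_succ, ih (by omega), ← Finset.sum_union]
      · refine Finset.sum_congr ?_ fun _ _ => rfl
        ext a
        simp only [Finset.mem_union, Finset.mem_filter, Finset.mem_univ, true_and,
          mem_setM_iff hk (show m < n by omega)]
        have h1 := rowWidth_sub k hm
        have h2 := hk (m + 1) (Finset.mem_Icc.mpr (by omega))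
        omega
      · rw [Finset.disjoint_left]
        intro a h1 h2
        simp only [Finset.mem_filter, Finset.mem_univ, true_and,
          mem_setM_iff hk (show m < n by omega)] at h1 h2
        have h3 := rowWidth_sub k hm
        have h4 := hk (m + 1) (Finset.mem_Icc.mpr (by omega))
        omega
  have hi := i.isLt
  rw [← Finset.sum_filter, ← key (i + 1) (by omega)]
  unfold proj projTwo projOne
  rw [Finset.sum_filter, Fin.sum_univ_eq_sum_range (fun j => if j ≤ (i : ℕ) then
    ∑ a ∈ Finset.univ.filter (fun a : Fin (rowWidth n k n) => (a : ℕ) + 1 ∈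
      setM k (rowWidth n k n) (j + 1)), x a else 0) n, ← Finset.sum_filter]
  refine Finset.sum_congr ?_ fun _ _ => rfl
  ext j
  simp only [Finset.mem_filter, Finset.mem_range]
  omega

/-- The labels vanish at the two omitted coordinates, so truncation does not affect the pairing. -/
theorem sum_mul_truncatedBrickVector {n : ℕ} {k : ℕ → ℕ} (hk : ∀ i ∈ Finset.Icc 1 n, 1 ≤ k i)
    (T : Finset (ℕ × ℕ)) (f : ℕ → ℕ) (h0 : f 0 = 0) (hN : f (rowWidth n k n + 1) = 0) :
    ∑ a : Fin (maxDist (nePath n k)), (f ((a : ℕ) + 1) : ℝ) * truncatedBrickVector (nePath n k) T a =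
      - ((∑ h ∈ Finset.range (n + 1), ∑ x ∈ Finset.range (rowWidth n k h + 1),
        ∑ i ∈ Finset.range (x + (n - h) + 1),
          pipeState n (readingOrder (nePath n k)) T f (x, h) i : ℕ) : ℝ) := by
  have hL := isReading_readingOrder hk
  rw [← hL.sum_map (fun p => ∑ i ∈ Finset.range (p.1 + (n - p.2) + 1),
    pipeState n (readingOrder (nePath n k)) T f p i), ← sum_mul_brickVector hL.sorted T
    (nuWord (nePath n k)) (fun j => by simp only [nuWord, distTopLeft, pathHeight_nePath]) f]
  rw [Fin.sum_univ_castSucc, Fin.sum_univ_succ]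
  rw [← maxDist_nePath_eq hk] at hN
  simp [h0, hN, truncatedBrickVector, nuBrickVector]

theorem yVector_minTree {n : ℕ} {k : ℕ → ℕ} (hk : ∀ i ∈ Finset.Icc 1 n, 1 ≤ k i)
    {T : Finset (ℕ × ℕ)} (hT : IsFacet n (rowWidth n k) T) (i : Fin (n - 1)) :
    yVector n k (minTree n (rowWidth n k)) T i = pathArea n (rowWidth n k) T (n - (i + 1)) := by
  have hW := isShape_rowWidth hk
  have hL := isReading_readingOrder hk
  set W := rowWidth n k with hWdef
  have hi := i.isLt
  set J := n - ((i : ℕ) + 1) with hJ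
  obtain ⟨A, B, hAB⟩ := hL.exists_sum_pipeState hW (J := J) (by omega)
  have hWJ := hW.add_le (show J ≤ n by omega) le_rfl
  have key : ∀ T, IsFacet n W T → proj n k (truncatedBrickVector (nePath n k) T) i =
      - ((∑ h ∈ Finset.range (n + 1), ∑ x ∈ Finset.range (W h + 1),
        ∑ i ∈ Finset.range (x + (n - h) + 1), (if 1 ≤ i ∧ i ≤ W n then 1 else 0) : ℕ) : ℝ) +
        (A + pathArea n W T J - B) := by
    intro T hT
    have h1 := sum_mul_truncatedBrickVector hk T (fun i => if 1 ≤ i ∧ i ≤ W n then 1 else 0)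
      (by simp) (by simp [hWdef])
    have h2 := sum_mul_truncatedBrickVector hk T (rowLabel n W J)
      (by simp [rowLabel]) (by rw [rowLabel, ← hWdef, if_neg]; omega)
    simp only [hL.pipeState_eq_self hW hT] at h1
    have h3 := hAB T hT
    rw [← hWdef] at h1 h2
    have h4 := congrArg (Nat.cast (R := ℝ)) h3
    rw [Nat.cast_add, Nat.cast_add] at h4
    rw [← eq_sub_iff_add_eq.mpr h4, ← h1, ← neg_eq_iff_eq_neg.mpr h2, ← sub_eq_add_neg,
      ← Finset.sum_sub_distrib, proj_apply hk (maxDist_nePath_eq hk)]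
    refine Finset.sum_congr rfl fun a _ => ?_
    have ha : (a : ℕ) < W n := lt_of_lt_of_eq a.isLt (maxDist_nePath_eq hk)
    rw [← sub_mul, ← hWdef, ← hJ, rowLabel,
      if_pos (show 1 ≤ (a : ℕ) + 1 ∧ (a : ℕ) + 1 ≤ W n by omega)]
    split_ifs
    · omega
    · simp
    · simp
    · omega
  have h1 := key T hT
  have h2 := key _ (isFacet_minTree hW)
  rw [pathArea_minTree hW] at h2
  simp only [yVector, Pi.sub_apply]
  rw [h1, h2]
  push_cast
  ring

/-! ### The cells of the realization -/

/-- The coordinate that belongs to the row at height `h`; it is zero for the first and the last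
row. -/
noncomputable def rowCoord (n h : ℕ) : (Fin (n - 1) → ℝ) →L[ℝ] ℝ :=
  if hh : 1 ≤ h ∧ h ≤ n - 1 then ContinuousLinearMap.proj ⟨n - 1 - h, by omega⟩ else 0

/-- The point `p = (x, h)` of the shape minimizes `y_h + x h` in its column. -/
def IsTight (n : ℕ) (W : ℕ → ℕ) (y : Fin (n - 1) → ℝ) (p : ℕ × ℕ) : Prop :=
  (p.2 ≤ n ∧ p.1 ≤ W p.2) ∧ ∀ h ≤ n, p.1 ≤ W h →
    rowCoord n p.2 y + (p.1 * p.2 : ℝ) ≤ rowCoord n h y + (p.1 * h : ℝ)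

open Classical in
/-- The set of tight points. -/
noncomputable def tightSet (n : ℕ) (W : ℕ → ℕ) (y : Fin (n - 1) → ℝ) : Finset (ℕ × ℕ) :=
  (Finset.range (W n + 1) ×ˢ Finset.range (n + 1)).filter (IsTight n W y)

/-- The cell of a face: all points of this face are tight. -/
def faceCell (n : ℕ) (W : ℕ → ℕ) (I : Finset (ℕ × ℕ)) : Set (Fin (n - 1) → ℝ) :=
  {y | ∀ p ∈ I, IsTight n W y p}

/-- The vertex of a facet. -/
noncomputable def facetVertex (n : ℕ) (W : ℕ → ℕ) (T : Finset (ℕ × ℕ)) : Fin (n - 1) → ℝ :=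
  fun i => pathArea n W T (n - (i + 1))

theorem rowCoord_top (n : ℕ) : rowCoord n n = 0 := dif_neg (by omega)

theorem mem_tightSet {n : ℕ} {W : ℕ → ℕ} (hW : IsShape n W) {y : Fin (n - 1) → ℝ} {p : ℕ × ℕ} :
    p ∈ tightSet n W y ↔ IsTight n W y p := by
  classical
  rw [tightSet, Finset.mem_filter, and_iff_right_iff_imp]
  rintro ⟨⟨h1, h2⟩, -⟩
  have := hW.le h1 le_rfl
  simp only [Finset.mem_product, Finset.mem_range]
  omega

theorem IsTight.eq {n : ℕ} {W : ℕ → ℕ} {y : Fin (n - 1) → ℝ} {x h h' : ℕ}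
    (h1 : IsTight n W y (x, h)) (h2 : IsTight n W y (x, h')) :
    rowCoord n h y + (x * h : ℝ) = rowCoord n h' y + (x * h' : ℝ) :=
  le_antisymm (h1.2 h' h2.1.1 h2.1.2) (h2.2 h h1.1.1 h1.1.2)

theorem IsTight.of_eq {n : ℕ} {W : ℕ → ℕ} {y : Fin (n - 1) → ℝ} {x h h' : ℕ}
    (h1 : IsTight n W y (x, h)) (hn : h' ≤ n) (hx : x ≤ W h')
    (he : rowCoord n h' y + (x * h' : ℝ) = rowCoord n h y + (x * h : ℝ)) :
    IsTight n W y (x, h') :=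
  ⟨⟨hn, hx⟩, fun s hs hxs => by simp only; rw [he]; exact h1.2 s hs hxs⟩

theorem isFace_tightSet {n : ℕ} {W : ℕ → ℕ} (hW : IsShape n W) (y : Fin (n - 1) → ℝ) :
    IsFace n W (tightSet n W y) := by
  refine ⟨fun a b hab => ((mem_tightSet hW).mp hab).1, fun a b c d hab hcd hac hbd => ?_⟩
  rw [mem_tightSet hW] at hab hcd
  by_contra hle
  have h1 := hab.2 d hcd.1.1 (by have := hcd.1.2; simp only at this ⊢; omega)
  have h2 := hcd.2 b hab.1.1 (by simp only; omega)
  simp only at h1 h2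
  have h3 : (a : ℝ) < c := by exact_mod_cast hac
  have h4 : (b : ℝ) < d := by exact_mod_cast hbd
  -- Adding the inequalities of the two columns would give `(c - a) * (d - b) ≤ 0`.
  nlinarith [mul_pos (sub_pos.mpr h3) (sub_pos.mpr h4)]

theorem rowCoord_facetVertex {n : ℕ} {W : ℕ → ℕ} {T : Finset (ℕ × ℕ)} (hW : IsShape n W)
    (hT : IsFacet n W T) {h : ℕ} (hh : h ≤ n) :
    rowCoord n h (facetVertex n W T) = pathArea n W T h := by
  unfold rowCoord
  split_ifs with h1
  · simp only [ContinuousLinearMap.proj_apply, facetVertex]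
    rw [show n - (n - 1 - h + 1) = h by omega]
  · rcases Nat.eq_zero_or_pos h with rfl | h2
    · simp [pathArea_zero hT hW]
    · obtain rfl : h = n := by omega
      simp [pathArea_top]

theorem isTight_facetVertex {n : ℕ} {W : ℕ → ℕ} {T : Finset (ℕ × ℕ)} (hW : IsShape n W)
    (hT : IsFacet n W T) {p : ℕ × ℕ} (hp : p ∈ T) : IsTight n W (facetVertex n W T) p := by
  obtain ⟨x, h⟩ := p
  have hh := hT.above x h hp
  refine ⟨hh, fun h' hh' hx => ?_⟩
  simp only at hx ⊢
  rw [rowCoord_facetVertex hW hT hh.1, rowCoord_facetVertex hW hT hh']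
  norm_cast
  rcases le_total h h' with hle | hle
  · have h1 := hT.pathArea_le_of_lt hW hp hle hh'
    have h2 : x * h + x * (h' - h) = x * h' := by rw [← mul_add]; congr 1; omega
    omega
  · have h1 := hT.pathArea_ge_of_gt hW hp hle hx
    have h2 : x * h' + x * (h - h') = x * h := by rw [← mul_add]; congr 1; omega
    omega

theorem tightSet_facetVertex {n : ℕ} {W : ℕ → ℕ} {T : Finset (ℕ × ℕ)} (hW : IsShape n W)
    (hT : IsFacet n W T) : tightSet n W (facetVertex n W T) = T :=
  hT.eq_of_subset (isFace_tightSet hW _) fun _ hp =>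
    (mem_tightSet hW).mpr (isTight_facetVertex hW hT hp)

/-- A vertex is determined by its tight set. -/
theorem eq_facetVertex {n : ℕ} {W : ℕ → ℕ} {T : Finset (ℕ × ℕ)} (hW : IsShape n W)
    (hT : IsFacet n W T) {y : Fin (n - 1) → ℝ} (hy : y ∈ faceCell n W T) :
    y = facetVertex n W T := by
  have key : ∀ m h, n - h = m → h ≤ n →
      rowCoord n h y = rowCoord n h (facetVertex n W T) := by
    intro m
    induction m using Nat.strong_induction_on with
    | _ m ih =>
      intro h hm hh
      rcases hh.eq_or_lt with rfl | hlt
      · rw [rowCoord_top]; rfl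
      · have hl := hT.leftmost_mem hW hh
        -- The leftmost node of a row below the top has a node to its north; both are tight, which
        -- expresses the coordinate of row `h` through that of row `d`, down from `y_n = 0`.
        obtain ⟨d, hd, hdT⟩ := (hT.north_or_west hl (by simp; omega)).resolve_right (by
          rintro ⟨c, hc, hcT⟩
          have := leftmost_le hcT
          omega)
        have hdn := (hT.above _ _ hdT).1
        have h1 := (hy _ hl).eq (hy _ hdT)
        have h2 := (isTight_facetVertex hW hT hl).eq (isTight_facetVertex hW hT hdT)
        have h3 := ih (n - d) (by omega) d rfl hdn
        linarith
  funext i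
  have hi := i.isLt
  have := key _ (n - 1 - i) rfl (by omega)
  unfold rowCoord at this
  rw [dif_pos (by omega)] at this
  simp only [ContinuousLinearMap.proj_apply] at this
  have he : (⟨n - 1 - (n - 1 - (i : ℕ)), by omega⟩ : Fin (n - 1)) = i := by
    ext
    simp only
    omega
  rwa [he] at this

theorem isTight_convex {n : ℕ} {W : ℕ → ℕ} (p : ℕ × ℕ) : Convex ℝ {y | IsTight n W y p} := by
  intro y hy z hz a b ha hb hab
  refine ⟨hy.1, fun h hh hx => ?_⟩
  have h1 := hy.2 h hh hx
  have h2 := hz.2 h hh hx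
  simp only [map_add, map_smul, smul_eq_mul]
  have h3 := mul_le_mul_of_nonneg_left h1 ha
  have h4 := mul_le_mul_of_nonneg_left h2 hb
  linear_combination h3 + h4 + (p.1 * (h - p.2) : ℝ) * hab

theorem faceCell_convex (n : ℕ) (W : ℕ → ℕ) (I : Finset (ℕ × ℕ)) :
    Convex ℝ (faceCell n W I) := by
  have : faceCell n W I = ⋂ p ∈ I, {y | IsTight n W y p} := by
    ext y
    simp [faceCell]
  rw [this]
  exact convex_iInter fun p => convex_iInter fun _ => isTight_convex p

theorem faceCell_isClosed (n : ℕ) (W : ℕ → ℕ) (I : Finset (ℕ × ℕ)) :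
    IsClosed (faceCell n W I) := by
  unfold faceCell IsTight
  simp only [Set.ofPred_forall, Set.ofPred_and]
  refine isClosed_iInter fun p => isClosed_iInter fun _ =>
    IsClosed.inter (isClosed_const.inter isClosed_const) ?_
  exact isClosed_iInter fun h => isClosed_iInter fun _ => isClosed_iInter fun _ =>
    isClosed_le (by fun_prop) (by fun_prop)

theorem faceCell_anti {n : ℕ} {W : ℕ → ℕ} {I J : Finset (ℕ × ℕ)} (h : I ⊆ J) :
    faceCell n W J ⊆ faceCell n W I := fun _ hy p hp => hy p (h hp)

theorem mem_faceCell_iff {n : ℕ} {W : ℕ → ℕ} (hW : IsShape n W) {I : Finset (ℕ × ℕ)}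
    {y : Fin (n - 1) → ℝ} : y ∈ faceCell n W I ↔ I ⊆ tightSet n W y :=
  ⟨fun h p hp => (mem_tightSet hW).mpr (h p hp), fun h _ hp => (mem_tightSet hW).mp (h hp)⟩

/-- The characterization of interior faces by the root, row ends and columns is inherited by larger
faces. -/
theorem isInterior_tightSet {n : ℕ} {W : ℕ → ℕ} (hW : IsShape n W) {I : Finset (ℕ × ℕ)}
    (hI : IsInterior n W I) {y : Fin (n - 1) → ℝ} (hy : y ∈ faceCell n W I) :
    IsInterior n W (tightSet n W y) := by
  have hsub := (mem_faceCell_iff hW).mp hy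
  refine IsInterior.of_mem hW (isFace_tightSet hW y) (hsub (hI.root_mem hW))
    (fun h hh => hsub (hI.end_mem hW hh)) fun x hx => ?_
  obtain ⟨h, hh⟩ := hI.exists_mem_column hW hx
  exact ⟨h, hsub hh⟩

/-- The cells of interior faces are bounded. -/
theorem faceCell_bound {n : ℕ} {W : ℕ → ℕ} (hW : IsShape n W) {I : Finset (ℕ × ℕ)}
    (hI : IsInterior n W I) {y : Fin (n - 1) → ℝ} (hy : y ∈ faceCell n W I) (i : Fin (n - 1)) :
    0 ≤ y i ∧ y i ≤ W n * n := by
  have hi := i.isLt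
  have hc : rowCoord n (n - 1 - i) y = y i := by
    unfold rowCoord
    rw [dif_pos (by omega)]
    simp only [ContinuousLinearMap.proj_apply]
    congr 1
    ext
    simp only
    omega
  -- Tightness of the root in column 0 gives the lower bound; tightness of the row end, compared
  -- with the top row, gives the upper one.
  have h1 := (hy _ (hI.root_mem hW)).2 (n - 1 - i) (by omega) (by simp)
  have h2 := (hy _ (hI.end_mem hW (show n - 1 - (i : ℕ) ≤ n by omega))).2 n le_rfl
    (hW.le (by omega) le_rfl)
  simp only [rowCoord_top, hc, zero_apply] at h1 h2
  have h3 : (W (n - 1 - i) : ℝ) ≤ W n := by exact_mod_cast hW.le (by omega) le_rfl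
  refine ⟨by simpa using h1, ?_⟩
  have h4 : (W (n - 1 - i) * n : ℝ) ≤ W n * n := by gcongr
  have h5 : (0 : ℝ) ≤ W (n - 1 - i) * ((n - 1 - i : ℕ) : ℝ) := by positivity
  linarith

/-- Moving a point of a cell in a direction that respects its tight set. -/
theorem eventually_mem_faceCell {n : ℕ} {W : ℕ → ℕ} (hW : IsShape n W) {y u : Fin (n - 1) → ℝ}
    (hu : ∀ x h h', (x, h) ∈ tightSet n W y → (x, h') ∈ tightSet n W y →
      rowCoord n h u = rowCoord n h' u) :
    ∀ᶠ t in nhds (0 : ℝ), y + t • u ∈ faceCell n W (tightSet n W y) := by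
  have key : ∀ p ∈ tightSet n W y, ∀ h ∈ Finset.range (n + 1), ∀ᶠ t in nhds (0 : ℝ), p.1 ≤ W h →
      rowCoord n p.2 (y + t • u) + (p.1 * p.2 : ℝ) ≤ rowCoord n h (y + t • u) + (p.1 * h : ℝ) := by
    rintro ⟨x, h⟩ hp h' hh'
    rw [Finset.mem_range] at hh'
    by_cases hx : x ≤ W h'
    swap
    · exact Filter.Eventually.of_forall fun t h => absurd h hx
    have htight := (mem_tightSet hW).mp hp
    simp only [map_add, map_smul, smul_eq_mul]
    -- An equality means that both points are tight, and then `u` preserves it; a strict inequality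
    -- survives for small `t`.
    rcases (htight.2 h' (by omega) hx).eq_or_lt with he | hlt
    · have h1 := hu x h h' hp ((mem_tightSet hW).mpr (htight.of_eq (by omega) hx he.symm))
      refine Filter.Eventually.of_forall fun t _ => ?_
      simp only at he
      rw [h1]
      linarith
    · have hcont : Continuous fun t : ℝ => (rowCoord n h' y + t * rowCoord n h' u + (x * h' : ℝ)) -
          (rowCoord n h y + t * rowCoord n h u + (x * h : ℝ)) := by fun_prop
      have h0 := hcont.tendsto 0
      simp only [zero_mul, add_zero] at h0
      filter_upwards [h0.eventually (lt_mem_nhds (sub_pos.mpr hlt))] with t ht _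
      linarith
  have := (Filter.eventually_all_finset _).mpr fun p hp =>
    (Filter.eventually_all_finset _).mpr (key p hp)
  filter_upwards [this] with t ht p hp
  exact ⟨((mem_tightSet hW).mp hp).1, fun h hh hx =>
    ht p hp h (Finset.mem_range.mpr (by omega)) hx⟩

theorem exists_pos_mem_faceCell {n : ℕ} {W : ℕ → ℕ} (hW : IsShape n W) {y u : Fin (n - 1) → ℝ}
    (hu : ∀ x h h', (x, h) ∈ tightSet n W y → (x, h') ∈ tightSet n W y →
      rowCoord n h u = rowCoord n h' u) :
    ∃ t > (0 : ℝ), y + t • u ∈ faceCell n W (tightSet n W y) := by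
  obtain ⟨ε, hε, h⟩ := Metric.eventually_nhds_iff.mp (eventually_mem_faceCell hW hu)
  refine ⟨ε / 2, by positivity, h ?_⟩
  rw [dist_zero_right, Real.norm_of_nonneg (by positivity)]
  linarith

/-- In a direction that respects the tight set, one can move until a new point becomes tight. -/
theorem exists_tightSet_ssubset {n : ℕ} {W : ℕ → ℕ} (hW : IsShape n W) {y u : Fin (n - 1) → ℝ}
    (hy : IsInterior n W (tightSet n W y)) (hu0 : u ≠ 0)
    (hu : ∀ x h h', (x, h) ∈ tightSet n W y → (x, h') ∈ tightSet n W y →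
      rowCoord n h u = rowCoord n h' u) :
    ∃ t > (0 : ℝ), tightSet n W y ⊂ tightSet n W (y + t • u) := by
  set J := tightSet n W y with hJ
  set K := {t : ℝ | 0 ≤ t ∧ y + t • u ∈ faceCell n W J} with hK
  obtain ⟨i, hi⟩ := Function.ne_iff.mp hu0
  simp only [Pi.zero_apply] at hi
  have hclosed : IsClosed K :=
    isClosed_Ici.inter ((faceCell_isClosed n W J).preimage (by fun_prop))
  have hbdd : BddAbove K := by
    refine ⟨(W n * n + |y i|) / |u i|, fun t ht => ?_⟩
    rw [le_div_iff₀ (abs_pos.mpr hi)]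
    have h1 := faceCell_bound hW hy ht.2 i
    simp only [Pi.add_apply, Pi.smul_apply, smul_eq_mul] at h1
    have h2 : t * |u i| = |t * u i| := by rw [abs_mul, abs_of_nonneg ht.1]
    rw [h2]
    have h3 := neg_abs_le (y i)
    have h4 := le_abs_self (y i)
    refine abs_le.mpr ⟨?_, ?_⟩
    · have : (0 : ℝ) ≤ W n * n := by positivity
      linarith [h1.1]
    · linarith [h1.2]
  obtain ⟨t0, ht0, hmem0⟩ := exists_pos_mem_faceCell hW hu
  have hne : K.Nonempty := ⟨t0, ht0.le, hmem0⟩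
  have hs := hclosed.csSup_mem hne hbdd
  have hpos : 0 < sSup K := lt_of_lt_of_le ht0 (le_csSup hbdd ⟨ht0.le, hmem0⟩)
  -- At the last admissible parameter the tight set must have grown, since otherwise a further small
  -- step would stay in the cell.
  refine ⟨sSup K, hpos, ((mem_faceCell_iff hW).mp hs.2).ssubset_of_ne fun he => ?_⟩
  rw [hJ] at he
  obtain ⟨t1, ht1, hmem1⟩ := exists_pos_mem_faceCell hW (y := y + sSup K • u) (u := u)
    (by rw [← he]; exact hu)
  rw [← he, add_assoc, ← add_smul] at hmem1
  have := le_csSup hbdd (show sSup K + t1 ∈ K from ⟨by linarith, hmem1⟩)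
  linarith

/-- The cell of an interior face is the convex hull of its vertices. -/
theorem faceCell_eq_convexHull {n : ℕ} {W : ℕ → ℕ} (hW : IsShape n W) {I : Finset (ℕ × ℕ)}
    (hI : IsInterior n W I) : faceCell n W I =
      convexHull ℝ (facetVertex n W '' {T | IsFacet n W T ∧ I ⊆ T}) := by
  apply Set.Subset.antisymm
  · have key : ∀ m y, (W n + 1) * (n + 1) - (tightSet n W y).card = m → y ∈ faceCell n W I →
        y ∈ convexHull ℝ (facetVertex n W '' {T | IsFacet n W T ∧ I ⊆ T}) := by
      intro m
      induction m using Nat.strong_induction_on with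
      | _ m ih =>
        intro y hm hy
        have hJ := isInterior_tightSet hW hI hy
        have hIJ := (mem_faceCell_iff hW).mp hy
        obtain ⟨T, hT, hJT⟩ := hJ.face.exists_isFacet hW
        by_cases hTJ : T ⊆ tightSet n W y
        · rw [eq_facetVertex hW hT ((mem_faceCell_iff hW).mpr hTJ)]
          exact subset_convexHull ℝ _ ⟨T, ⟨hT, hIJ.trans hJT⟩, rfl⟩
        obtain ⟨q, hqT, hqJ⟩ := Finset.not_subset.mp hTJ
        obtain ⟨T', hT', hne, -, hJT', -⟩ := hJ.exists_notMem hT hJT hqT hqJ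
        have hlt : ∀ z, tightSet n W y ⊂ tightSet n W z →
            z ∈ convexHull ℝ (facetVertex n W '' {T | IsFacet n W T ∧ I ⊆ T}) := by
          intro z hz
          have h1 := Finset.card_lt_card hz
          have h2 : (tightSet n W z).card ≤ (W n + 1) * (n + 1) := by
            classical
            refine (Finset.card_filter_le _ (fun p => IsTight n W z p)).trans ?_
            rw [Finset.card_product, Finset.card_range, Finset.card_range]
          exact ih _ (by omega) z rfl ((mem_faceCell_iff hW).mpr (hIJ.trans hz.subset))
        have hu : ∀ x h h', (x, h) ∈ tightSet n W y → (x, h') ∈ tightSet n W y →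
            rowCoord n h (facetVertex n W T' - facetVertex n W T) =
              rowCoord n h' (facetVertex n W T' - facetVertex n W T) := by
          intro x h h' hh hh'
          have h1 := (isTight_facetVertex hW hT (hJT hh)).eq (isTight_facetVertex hW hT (hJT hh'))
          have h2 := (isTight_facetVertex hW hT' (hJT' hh)).eq
            (isTight_facetVertex hW hT' (hJT' hh'))
          rw [map_sub, map_sub]
          linarith
        have hu0 : facetVertex n W T' - facetVertex n W T ≠ 0 := by
          intro h0
          apply hne
          rw [← tightSet_facetVertex hW hT', sub_eq_zero.mp h0, tightSet_facetVertex hW hT]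
        -- Both vertices lie in the cell of the tight set, so their difference is an admissible
        -- direction. Moving both ways until new points become tight exhibits `y` as a convex
        -- combination of two points covered by induction.
        obtain ⟨t, ht, hts⟩ := exists_tightSet_ssubset hW hJ hu0 hu
        obtain ⟨s, hs, hss⟩ := exists_tightSet_ssubset hW hJ (neg_ne_zero.mpr hu0)
          (fun x h h' hh hh' => by rw [map_neg, map_neg, hu x h h' hh hh'])
        have hconv := convex_convexHull ℝ (facetVertex n W '' {T | IsFacet n W T ∧ I ⊆ T})
        have hmem := hconv (hlt _ hts) (hlt _ hss) (a := s / (s + t)) (b := t / (s + t))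
          (by positivity) (by positivity) (by field_simp)
        convert hmem using 1
        funext i
        simp only [Pi.add_apply, Pi.smul_apply, Pi.neg_apply, smul_eq_mul]
        field_simp
        ring
    exact fun y hy => key _ y rfl hy
  · refine convexHull_min ?_ (faceCell_convex n W I)
    rintro _ ⟨T, ⟨hT, hIT⟩, rfl⟩
    exact fun p hp => isTight_facetVertex hW hT (hIT hp)

/-- The order on the cells. -/
theorem faceCell_subset_iff {n : ℕ} {W : ℕ → ℕ} (hW : IsShape n W) {I J : Finset (ℕ × ℕ)}
    (hI : IsInterior n W I) : faceCell n W I ⊆ faceCell n W J ↔ J ⊆ I := by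
  refine ⟨fun h q hq => ?_, faceCell_anti⟩
  by_contra hqI
  have key : ∀ T, IsFacet n W T → I ⊆ T → q ∈ T := fun T hT hIT => by
    have h1 : facetVertex n W T ∈ faceCell n W I := fun p hp => isTight_facetVertex hW hT (hIT hp)
    have h2 := (mem_faceCell_iff hW).mp (h h1) hq
    rwa [tightSet_facetVertex hW hT] at h2
  obtain ⟨T, hT, hIT⟩ := hI.face.exists_isFacet hW
  obtain ⟨T', hT', -, -, hIT', hqT'⟩ := hI.exists_notMem hT hIT (key T hT hIT) hqI
  exact hqT' (key T' hT' hIT')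

theorem faceCell_nonempty {n : ℕ} {W : ℕ → ℕ} (hW : IsShape n W) {I : Finset (ℕ × ℕ)}
    (hI : IsInterior n W I) : (faceCell n W I).Nonempty := by
  obtain ⟨T, hT, hIT⟩ := hI.face.exists_isFacet hW
  exact ⟨facetVertex n W T, fun p hp => isTight_facetVertex hW hT (hIT hp)⟩

/-- The faces of a cell are cells. -/
theorem exists_faceCell_eq_of_isExposed {n : ℕ} {W : ℕ → ℕ} (hW : IsShape n W)
    {I : Finset (ℕ × ℕ)} (hI : IsInterior n W I) {F : Set (Fin (n - 1) → ℝ)} (hF : F.Nonempty)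
    (hexp : IsExposed ℝ (faceCell n W I) F) : ∃ J, IsInterior n W J ∧ faceCell n W J = F := by
  obtain ⟨l, hl⟩ := hexp hF
  have hFmem : ∀ y, y ∈ F ↔ y ∈ faceCell n W I ∧ ∀ z ∈ faceCell n W I, l z ≤ l y := fun y => by
    rw [hl]; rfl
  -- A point of `F` with the fewest tight points plays the role of a relative interior point.
  have hex : ∃ m, ∃ y ∈ F, (tightSet n W y).card = m := ⟨_, hF.some, hF.some_mem, rfl⟩
  classical
  obtain ⟨⟨y, hyF, hcard⟩, hmin⟩ := And.intro (Nat.find_spec hex)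
    (fun m (hm : m < Nat.find hex) => Nat.find_min hex hm)
  rw [← hcard] at hmin
  obtain ⟨hyI, hymax⟩ := (hFmem y).mp hyF
  have hJ := isInterior_tightSet hW hI hyI
  refine ⟨tightSet n W y, hJ, Set.Subset.antisymm ?_ ?_⟩
  · intro z hz
    have hIJ := (mem_faceCell_iff hW).mp hyI
    -- The segment from `z` to `y` can be prolonged beyond `y` inside the cell, so maximality of `l`
    -- at `y` forces `l z` to be maximal too.
    obtain ⟨t, ht, hmem⟩ := exists_pos_mem_faceCell hW (y := y) (u := y - z) (by
      intro x h h' hh hh'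
      have h1 := ((mem_tightSet hW).mp hh).eq ((mem_tightSet hW).mp hh')
      have h2 := (hz _ hh).eq (hz _ hh')
      rw [map_sub, map_sub]
      linarith)
    have h3 := hymax _ (faceCell_anti hIJ hmem)
    rw [map_add, map_smul, map_sub, smul_eq_mul] at h3
    have h4 : l y ≤ l z := by
      by_contra h5
      have := mul_pos ht (sub_pos.mpr (not_le.mp h5))
      linarith
    exact (hFmem z).mpr ⟨faceCell_anti hIJ hz, fun w hw => (hymax w hw).trans h4⟩
  · intro z hz
    obtain ⟨hzI, hzmax⟩ := (hFmem z).mp hz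
    set w := (1 / 2 : ℝ) • y + (1 / 2 : ℝ) • z with hw
    have hwI : w ∈ faceCell n W I :=
      faceCell_convex n W I hyI hzI (by norm_num) (by norm_num) (by norm_num)
    have hwF : w ∈ F := by
      refine (hFmem w).mpr ⟨hwI, fun v hv => ?_⟩
      have h1 := hymax v hv
      have h2 := hzmax v hv
      rw [hw, map_add, map_smul, map_smul, smul_eq_mul, smul_eq_mul]
      linarith
    have hsub : ∀ p ∈ tightSet n W w, IsTight n W y p ∧ IsTight n W z p := by
      rintro ⟨x, h⟩ hp
      rw [mem_tightSet hW] at hp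
      obtain ⟨⟨hh, hx⟩, -⟩ := id hp
      -- The point of `I` in this column is tight at `y`, `z` and `w`. The difference to it is
      -- nonnegative at `y` and `z` and vanishes at their midpoint, hence vanishes at both.
      obtain ⟨h0, hh0⟩ := hI.exists_mem_column hW (hx.trans (hW.le hh le_rfl))
      have h1 := hp.eq (hwI _ hh0)
      have h2 := (hyI _ hh0).2 h hh hx
      have h3 := (hzI _ hh0).2 h hh hx
      simp only [hw, map_add, map_smul, smul_eq_mul] at h1 h2 h3
      exact ⟨(hyI _ hh0).of_eq hh hx (by linarith), (hzI _ hh0).of_eq hh hx (by linarith)⟩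
    have hwy : tightSet n W w ⊆ tightSet n W y := fun p hp => (mem_tightSet hW).mpr (hsub p hp).1
    have heq : tightSet n W w = tightSet n W y := by
      refine Finset.eq_of_subset_of_card_le hwy (not_lt.mp fun hlt => ?_)
      exact hmin _ hlt ⟨w, hwF, rfl⟩
    intro p hp
    exact (hsub p (heq ▸ hp)).2

/-- The intersection of two cells is a face of both of them. -/
theorem isExposed_faceCell_inter {n : ℕ} {W : ℕ → ℕ} (hW : IsShape n W) {I J : Finset (ℕ × ℕ)}
    (hI : IsInterior n W I) (hJ : IsFace n W J) :
    IsExposed ℝ (faceCell n W I) (faceCell n W I ∩ faceCell n W J) := by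
  rintro ⟨z, hzI, hzJ⟩
  have hrep : ∀ p : ℕ × ℕ, ∃ h, p ∈ J → (p.1, h) ∈ I := by
    rintro ⟨x, h⟩
    by_cases hp : (x, h) ∈ J
    · obtain ⟨hh, hx⟩ := hJ.above x h hp
      obtain ⟨h0, hh0⟩ := hI.exists_mem_column hW (hx.trans (hW.le hh le_rfl))
      exact ⟨h0, fun _ => hh0⟩
    · exact ⟨0, fun h => absurd h hp⟩
  choose r hr using hrep
  -- Each summand compares `p` with a point of `I` in its column; on the cell of `I` it is bounded
  -- above by a constant, attained exactly where `p` is tight. So `l` is maximal exactly where all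
  -- of `J` is tight.
  set l : StrongDual ℝ (Fin (n - 1) → ℝ) :=
    ∑ p ∈ J, (rowCoord n (r p) - rowCoord n p.2) with hl
  have hle : ∀ y ∈ faceCell n W I, ∀ p ∈ J, rowCoord n (r p) y - rowCoord n p.2 y ≤
      (p.1 * p.2 - p.1 * r p : ℝ) := by
    intro y hy p hp
    have h1 := (hy _ (hr p hp)).2 p.2 (hJ.above p.1 p.2 hp).1 (hJ.above p.1 p.2 hp).2
    simp only at h1
    linarith
  have happly : ∀ y, l y = ∑ p ∈ J, (rowCoord n (r p) y - rowCoord n p.2 y) := fun y => by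
    simp [hl]
  have hmax : ∀ y ∈ faceCell n W I, l y ≤ ∑ p ∈ J, (p.1 * p.2 - p.1 * r p : ℝ) := fun y hy => by
    rw [happly]
    exact Finset.sum_le_sum (hle y hy)
  have heq : ∀ y ∈ faceCell n W I, y ∈ faceCell n W J →
      l y = ∑ p ∈ J, (p.1 * p.2 - p.1 * r p : ℝ) := by
    intro y hy hyJ
    rw [happly]
    refine Finset.sum_congr rfl fun p hp => ?_
    have := (hy _ (hr p hp)).eq (hyJ p hp)
    linarith
  refine ⟨l, Set.ext fun y => ⟨fun hy => ⟨hy.1, fun w hw => ?_⟩, fun hy => ⟨hy.1, ?_⟩⟩⟩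
  · rw [heq y hy.1 hy.2]
    exact hmax w hw
  · have h1 := hy.2 z hzI
    rw [heq z hzI hzJ, happly] at h1
    have h2 := (Finset.sum_eq_sum_iff_of_le (hle y hy.1)).mp
      (le_antisymm (Finset.sum_le_sum (hle y hy.1)) h1)
    intro p hp
    have h3 := h2 p hp
    exact (hy.1 _ (hr p hp)).of_eq (hJ.above p.1 p.2 hp).1 (hJ.above p.1 p.2 hp).2 (by linarith)

/-- The cells of the interior faces form a polytopal complex. -/
theorem isPolytopalComplex_faceCell {n : ℕ} {W : ℕ → ℕ} (hW : IsShape n W) :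
    IsPolytopalComplex (faceCell n W '' {I | IsInterior n W I}) where
  finite := ((finite_isFace hW).subset fun _ hI => hI.face).image _
  nonempty := by
    rintro _ ⟨I, hI, rfl⟩
    exact faceCell_nonempty hW hI
  polytope := by
    rintro _ ⟨I, hI, rfl⟩
    have hfin : (facetVertex n W '' {T | IsFacet n W T ∧ I ⊆ T}).Finite :=
      ((finite_isFace hW).subset fun _ hT => hT.1.toIsFace).image _
    exact ⟨hfin.toFinset, by rw [hfin.coe_toFinset, faceCell_eq_convexHull hW hI]⟩
  face_mem := by
    rintro _ ⟨I, hI, rfl⟩ F hF hexp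
    obtain ⟨J, hJ, rfl⟩ := exists_faceCell_eq_of_isExposed hW hI hF hexp
    exact ⟨J, hJ, rfl⟩
  inter_face := by
    rintro _ ⟨I, hI, rfl⟩ _ ⟨J, hJ, rfl⟩
    refine ⟨isExposed_faceCell_inter hW hI hJ.face, ?_⟩
    rw [Set.inter_comm]
    exact isExposed_faceCell_inter hW hJ hI.face

/-! ### The main theorem -/

theorem isInterior_nePath_iff {n : ℕ} {k : ℕ → ℕ} (hk : ∀ i ∈ Finset.Icc 1 n, 1 ≤ k i)
    {I : Finset (ℕ × ℕ)} : IsInteriorFace (nePath n k) I ↔ IsInterior n (rowWidth n k) I := by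
  unfold IsInteriorFace
  simp only [isTamariFace_nePath_iff hk, isNuTree_nePath_iff hk]
  exact ⟨fun h => ⟨h.1, h.2⟩, fun h => ⟨h.face, h.exists_flip⟩⟩

/-- A left rotation lowers the sum of the heights of the nodes. Read backwards, it is the last right
rotation of a chain that starts at `minTree`. -/
theorem isLeastNuTree_minTree {n : ℕ} {k : ℕ → ℕ} (hk : ∀ i ∈ Finset.Icc 1 n, 1 ≤ k i) :
    IsLeastNuTree (nePath n k) (minTree n (rowWidth n k)) := by
  have hW := isShape_rowWidth hk
  refine ⟨(isNuTree_nePath_iff hk).mpr (isFacet_minTree hW), fun T hT => ?_⟩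
  rw [isNuTree_nePath_iff hk] at hT
  induction hm : ∑ p ∈ T, p.2 using Nat.strong_induction_on generalizing T with
  | _ m ih =>
    by_cases hne : T = minTree n (rowWidth n k)
    · rw [hne]
    obtain ⟨x, y, x', y', hx, hy, hq, hp, hr, hrow, hcol⟩ := hT.exists_left_flip hW hne
    have hT' := hT.left_flip hW hx hy hq hp hr hrow hcol
    have hnew : (x, y) ∉ T := fun h => by
      have h1 := hT.compat x y x' y' h hq hx hy
      have h2 := (hT.above x' y hr).2
      omega
    set T' := insert (x, y) (T.erase (x', y')) with hT'def
    have hsum : ∑ p ∈ T', p.2 < ∑ p ∈ T, p.2 := by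
      rw [hT'def, Finset.sum_insert (fun h => hnew (Finset.mem_of_mem_erase h)),
        ← Finset.add_sum_erase T (fun p => p.2) hq]
      exact Nat.add_lt_add_right hy _
    refine (ih _ (hm ▸ hsum) T' hT' rfl).tail
      ⟨(isNuTree_nePath_iff hk).mpr hT', (isNuTree_nePath_iff hk).mpr hT, (x, y'), (x, y), (x', y),
        rfl, hy, rfl, hx, ?_, ?_⟩
    · ext ⟨a, b⟩
      simp only [hT'def, Finset.mem_inter, Finset.mem_insert, Finset.mem_erase, Finset.mem_Icc,
        Finset.mem_singleton, Prod.mk.injEq, Prod.mk_le_mk, ne_eq]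
      constructor
      · rintro ⟨h1 | ⟨h1, h2⟩, ⟨h3, h4⟩, h5, h6⟩
        · omega
        · rcases h6.eq_or_lt with rfl | h6
          · rcases h5.eq_or_lt with rfl | h5
            · omega
            · rcases h3.eq_or_lt with rfl | h3
              · omega
              · exact absurd h2 (hrow a h3 h5)
          · rcases h5.eq_or_lt with rfl | h5
            · rcases h4.eq_or_lt with rfl | h4
              · omega
              · exact absurd h2 (hcol b h4 h6)
            · have h7 := hT.compat a b x' y' h2 hq h5 h6
              have h8 := (hT.above x' y hr).2
              have h9 := hW.le h4 (by have := (hT.above x' y' hq).1; omega)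
              omega
      · rintro (⟨rfl, rfl⟩ | ⟨rfl, rfl⟩ | ⟨rfl, rfl⟩)
        · exact ⟨Or.inr ⟨by omega, hp⟩, by omega, by omega⟩
        · exact ⟨Or.inl ⟨rfl, rfl⟩, by omega, by omega⟩
        · exact ⟨Or.inr ⟨by omega, hr⟩, by omega, by omega⟩
    · simp only
      rw [hT'def, Finset.erase_insert (fun h => hnew (Finset.mem_of_mem_erase h)),
        Finset.insert_erase hq]

theorem realizes_nePath {n : ℕ} {k : ℕ → ℕ} (hk : ∀ i ∈ Finset.Icc 1 n, 1 ≤ k i) :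
    RealizesNuAssociahedron (nePath n k) (yVector n k (minTree n (rowWidth n k))) := by
  have hW := isShape_rowWidth hk
  set W := rowWidth n k with hWdef
  have hint := fun {I} => isInterior_nePath_iff hk (I := I)
  refine ⟨faceCell n W '' {I | IsInterior n W I}, isPolytopalComplex_faceCell hW, ?_⟩
  set f : {I : Finset (ℕ × ℕ) // IsInteriorFace (nePath n k) I} →
      (↥(faceCell n W '' {I | IsInterior n W I}))ᵒᵈ :=
    fun I => OrderDual.toDual ⟨faceCell n W I.1, I.1, hint.mp I.2, rfl⟩ with hf
  have hle : ∀ I J, f I ≤ f J ↔ I ≤ J := fun I J => faceCell_subset_iff hW (hint.mp J.2)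
  have hbij : Function.Bijective f := by
    refine ⟨fun I J h => le_antisymm ((hle I J).mp h.le) ((hle J I).mp h.ge), ?_⟩
    rintro ⟨_, I, hI, rfl⟩
    exact ⟨⟨I, hint.mpr hI⟩, rfl⟩
  refine ⟨⟨Equiv.ofBijective f hbij, hle _ _⟩, fun I => ?_⟩
  trans faceCell n W I.1
  · rfl
  rw [faceCell_eq_convexHull hW (hint.mp I.2)]
  congr 1
  simp only [isNuTree_nePath_iff hk]
  exact Set.image_congr fun T hT => funext fun i => (yVector_minTree hk hT.1 i).symm

theorem mainTheorem3 (n : ℕ) (hn : 1 ≤ n) (k : ℕ → ℕ) (hk : ∀ i ∈ Finset.Icc 1 n, 1 ≤ k i) :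
    ∃ T₀ : Finset (ℕ × ℕ), IsLeastNuTree (nePath n k) T₀ ∧
      (∀ T : Finset (ℕ × ℕ), IsNuTree (nePath n k) T → ∀ i : Fin (n - 1),
        ∃ (v : ℕ × ℕ) (P : (treeGraph T).Walk (nuRoot (nePath n k)) v),
          IsLeftmostNode T (n - ((i : ℕ) + 1)) v ∧
          IsShortestWalk P ∧ (∀ P', IsShortestWalk P' → P' = P) ∧
          yVector n k T₀ T i = (walkArea (nePath n k) P : ℝ)) ∧
      RealizesNuAssociahedron (nePath n k) (yVector n k T₀) := by
  refine ⟨minTree n (rowWidth n k), isLeastNuTree_minTree hk, fun T hT i => ?_,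
    realizes_nePath hk⟩
  rw [isNuTree_nePath_iff hk] at hT
  have hW := isShape_rowWidth hk
  obtain ⟨P, h1, h2, h3⟩ := hT.exists_shortestWalk hW (pathHeight_nePath n k)
    (pathWidth_nePath n k) (J := n - ((i : ℕ) + 1)) (by omega)
  refine ⟨_, P, ⟨hT.leftmost_mem hW (by omega), rfl, ?_⟩, h1, h2, ?_⟩
  · rintro ⟨a, b⟩ hab rfl
    exact leftmost_le hab
  · rw [yVector_minTree hk hT, h3]
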